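/- A graph is $(C_4,\text{diamond})$-free if it contains neither the cycle $C_4$ on four vertices nor the diamond ($K_4$ minus one edge) as an induced subgraph. A finite graph is $3$-connected if it has more than three vertices and remains connected whenever at most two vertices are removed. For a graph $G$ on $n$ vertices and $1\le k\le n-1$, the $k$-token graph $F_k(G)$ is the graph whose vertices are the $k$-element subsets of $V(G)$, two of them being adjacent if their symmetric difference is a pair of adjacent vertices of $G$. There is a polynomial-time algorithm which, given as its only input a graph $F$ that is isomorphic to $F_k(G)$ for some $3$-connected $(C_4,\text{diamond})$-free graph $G$ on $n$ vertices and some $1\le k\le n-1$ (neither $G$, $n$, $k$ nor an isomorphism $F\to F_k(G)$ being given), computes a graph $H$ isomorphic to $G$. -/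

import Mathlib

open scoped SimpleGraph

/-! ### Graphs -/

/-- The `k`-token graph of `G`: its vertices are the sets of `k` vertices of `G`, and two of them
are adjacent if their symmetric difference is a pair of adjacent vertices of `G`. -/
def tokenGraph {V : Type*} [DecidableEq V] (G : SimpleGraph V) (k : ℕ) :
    SimpleGraph {A : Finset V // A.card = k} where
  Adj A B := ∃ a b : V, G.Adj a b ∧ symmDiff A.1 B.1 = {a, b}
  symm := ⟨by
    rintro A B ⟨a, b, hab, h⟩
    exact ⟨a, b, hab, by rw [symmDiff_comm, h]⟩⟩
  loopless := ⟨by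
    rintro A ⟨a, b, -, h⟩
    have ha : a ∈ ({a, b} : Finset V) := by simp
    rw [← h, symmDiff_self] at ha
    simp at ha⟩

/-- The diamond: the complete graph on four vertices minus one edge. -/
def diamondGraph : SimpleGraph (Fin 4) :=
  (⊤ : SimpleGraph (Fin 4)).deleteEdges {s(0, 1)}

/-- A graph is (`C₄`, diamond)-free if it contains neither the cycle on four vertices nor the
diamond as an induced subgraph. -/
def IsC4DiamondFree {V : Type*} (G : SimpleGraph V) : Prop :=
  ¬ (SimpleGraph.cycleGraph 4 ⊴ G) ∧ ¬ (diamondGraph ⊴ G)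

/-- A finite graph is `c`-connected if it has more than `c` vertices and remains connected
whenever fewer than `c` vertices are removed. -/
def IsVertexConnected {V : Type*} [Fintype V] (G : SimpleGraph V) (c : ℕ) : Prop :=
  c < Fintype.card V ∧
    ∀ S : Finset V, S.card < c → (G.induce {v : V | v ∉ S}).Connected

/-! ### Random access machines

A random access machine has registers and arrays of registers, named by natural numbers; each
register and each array cell holds a natural number. A program mentions finitely many names. The
arithmetic instructions are addition and truncated subtraction only, and every instruction and every
test costs one step. The bit length of the largest number in use thus grows by at most one in a
step (apart from the constants in the program), so polynomial time on this machine agrees with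
polynomial time on Turing machines. -/

namespace RAM

/-- A memory state: the contents of the registers and of the arrays. -/
structure State where
  /-- `reg x` is the content of register `x`. -/
  reg : ℕ → ℕ
  /-- `arr a i` is the content of cell `i` of array `a`. -/
  arr : ℕ → ℕ → ℕ

/-- Write `v` into register `x`. -/
def State.setReg (s : State) (x v : ℕ) : State :=
  { s with reg := Function.update s.reg x v }

/-- Write `v` into cell `i` of array `a`. -/
def State.setArr (s : State) (a i v : ℕ) : State :=
  { s with arr := Function.update s.arr a (Function.update (s.arr a) i v) }

/-- Programs. -/
inductive Prog : Type
  /-- `x := c` for a constant `c` -/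
  | const (x c : ℕ)
  /-- `x := y` -/
  | copy (x y : ℕ)
  /-- `x := y + z` -/
  | add (x y z : ℕ)
  /-- `x := y - z`, which is `0` if `y ≤ z` -/
  | sub (x y z : ℕ)
  /-- `x := a[y]` -/
  | load (x a y : ℕ)
  /-- `a[x] := y` -/
  | store (a x y : ℕ)
  /-- first `P`, then `Q` -/
  | seq (P Q : Prog)
  /-- `P` if `x ≠ 0`, and `Q` otherwise -/
  | cond (x : ℕ) (P Q : Prog)
  /-- repeat `P` as long as `x ≠ 0` -/
  | loop (x : ℕ) (P : Prog)

/-- `Runs P s s' t`: started in state `s`, the program `P` halts in state `s'` after exactly `t`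
steps. -/
inductive Runs : Prog → State → State → ℕ → Prop
  | const (x c : ℕ) (s : State) : Runs (.const x c) s (s.setReg x c) 1
  | copy (x y : ℕ) (s : State) : Runs (.copy x y) s (s.setReg x (s.reg y)) 1
  | add (x y z : ℕ) (s : State) : Runs (.add x y z) s (s.setReg x (s.reg y + s.reg z)) 1
  | sub (x y z : ℕ) (s : State) : Runs (.sub x y z) s (s.setReg x (s.reg y - s.reg z)) 1
  | load (x a y : ℕ) (s : State) : Runs (.load x a y) s (s.setReg x (s.arr a (s.reg y))) 1
  | store (a x y : ℕ) (s : State) : Runs (.store a x y) s (s.setArr a (s.reg x) (s.reg y)) 1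
  | seq {P Q : Prog} {s s₁ s₂ : State} {t₁ t₂ : ℕ} (h₁ : Runs P s s₁ t₁) (h₂ : Runs Q s₁ s₂ t₂) :
      Runs (.seq P Q) s s₂ (t₁ + t₂)
  | cond_true {x : ℕ} {P Q : Prog} {s s₁ : State} {t : ℕ} (hx : s.reg x ≠ 0)
      (h : Runs P s s₁ t) : Runs (.cond x P Q) s s₁ (t + 1)
  | cond_false {x : ℕ} {P Q : Prog} {s s₁ : State} {t : ℕ} (hx : s.reg x = 0)
      (h : Runs Q s s₁ t) : Runs (.cond x P Q) s s₁ (t + 1)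
  | loop_done {x : ℕ} {P : Prog} {s : State} (hx : s.reg x = 0) : Runs (.loop x P) s s 1
  | loop_step {x : ℕ} {P : Prog} {s s₁ s₂ : State} {t₁ t₂ : ℕ} (hx : s.reg x ≠ 0)
      (h₁ : Runs P s s₁ t₁) (h₂ : Runs (.loop x P) s₁ s₂ t₂) :
      Runs (.loop x P) s s₂ (t₁ + t₂ + 1)

/-- The state `s` holds the graph `H` on the vertices `0, …, m - 1`: register `0` contains `m`, and
array `0` contains the adjacency matrix of `H`, row by row. -/
def Holds {m : ℕ} (s : State) (H : SimpleGraph (Fin m)) : Prop :=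
  s.reg 0 = m ∧ ∀ i j : Fin m,
    (H.Adj i j → s.arr 0 (i * m + j) = 1) ∧ (¬ H.Adj i j → s.arr 0 (i * m + j) = 0)

open Classical in
/-- The initial state on input `F`: register `0` contains the number of vertices of `F`, array `0`
contains the adjacency matrix of `F`, row by row, and everything else is `0`. -/
noncomputable def input {N : ℕ} (F : SimpleGraph (Fin N)) : State where
  reg x := if x = 0 then N else 0
  arr a c := if a = 0 ∧ ∃ i j : Fin N, F.Adj i j ∧ c = i * N + j then 1 else 0

end RAM

/-!
The label of an edge of the token graph `Γ` is the edge of `G` along which a token moves. Since `G`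
has no induced `C₄` or diamond, nonadjacent vertices of `G` have at most one common neighbor, which
forces opposite edges of an induced `C₄` of `Γ` to have equal labels. Conversely, two edges of `Γ`
with the label `ac` differ by the position of `k - 1` tokens on `G - {a, c}`, which is connected,
and each move of one of these tokens gives an induced `C₄` in `Γ`. So the equality of labels is the
equivalence relation generated by opposite edges of induced cycles.

A path on three vertices of `Γ` which is not part of an induced `C₄` has two labels with exactly one
common vertex `b`, and it stands for `b`. Whether `b` lies in the label of an edge `e` is decided by
whether the label of `e` equals one of the two labels, or meets both without closing a triangle
with them. Two vertices of `G` are adjacent if they are different and lie in one label. Passing from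
`k` to `n - k` we may assume `k + 2 ≤ n`, and then all paths and triangles of `G` occur as labels of
paths and triangles of `Γ`. All this is a transitive closure followed by first-order conditions on
vertices of `Γ`, which loops over those vertices decide in polynomial time.
-/

/-! ### Token graphs -/

theorem IsC4DiamondFree.eq_of_common_neighbors {V : Type*} {G : SimpleGraph V}
    (hG : IsC4DiamondFree G) {u v p q : V} (huv : u ≠ v) (h : ¬ G.Adj u v) (hup : G.Adj u p)
    (hvp : G.Adj v p) (huq : G.Adj u q) (hvq : G.Adj v q) : p = q := by
  by_contra hpq
  have h' : ¬ G.Adj v u := fun hvu => h hvu.symm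
  by_cases hadj : G.Adj p q
  · refine hG.2 ⟨⟨⟨![u, v, p, q], fun i j => ?_⟩, fun {i j} => ?_⟩⟩
    · fin_cases i <;> fin_cases j <;>
        simp [huv, huv.symm, hup.ne, hup.ne', hvp.ne, hvp.ne', huq.ne, huq.ne', hvq.ne, hvq.ne',
          hpq, Ne.symm hpq]
    · change G.Adj (![u, v, p, q] i) (![u, v, p, q] j) ↔ _
      fin_cases i <;> fin_cases j <;>
        simp [diamondGraph, h, h', hup, hup.symm, hvp, hvp.symm, huq, huq.symm, hvq,
          hvq.symm, hadj, hadj.symm]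
  · have hadj' : ¬ G.Adj q p := fun hqp => hadj hqp.symm
    refine hG.1 ⟨⟨⟨![u, p, v, q], fun i j => ?_⟩, fun {i j} => ?_⟩⟩
    · fin_cases i <;> fin_cases j <;>
        simp [huv, huv.symm, hup.ne, hup.ne', hvp.ne, hvp.ne', huq.ne, huq.ne', hvq.ne, hvq.ne',
          hpq, Ne.symm hpq]
    · have hneg₂ : (-2 : Fin 4) ≠ 1 := by decide
      have hneg₃ : (-3 : Fin 4) = 1 := by decide
      change G.Adj (![u, p, v, q] i) (![u, p, v, q] j) ↔ _
      fin_cases i <;> fin_cases j <;>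
        simp [SimpleGraph.cycleGraph_adj, h, h', hup, hup.symm, hvp, hvp.symm, huq,
          huq.symm, hvq, hvq.symm, hadj, hadj', hneg₂, hneg₃]

theorem symmDiff_insert_insert {α : Type*} [DecidableEq α] {S : Finset α} {a b : α} (hab : a ≠ b)
    (ha : a ∉ S) (hb : b ∉ S) : symmDiff (insert a S) (insert b S) = {a, b} := by
  ext v
  simp only [Finset.mem_symmDiff, Finset.mem_insert, Finset.mem_singleton]
  grind

section TokenGraph

variable {V : Type*} [DecidableEq V] {G : SimpleGraph V} {k : ℕ}

theorem tokenGraph_adj_of_eq_insert {A B : {A : Finset V // A.card = k}} {S : Finset V} {a b : V}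
    (hab : G.Adj a b) (ha : a ∉ S) (hb : b ∉ S) (hA : A.1 = insert a S) (hB : B.1 = insert b S) :
    (tokenGraph G k).Adj A B :=
  ⟨a, b, hab, by rw [hA, hB, symmDiff_insert_insert hab.ne ha hb]⟩

theorem card_insert_erase {A : Finset V} {a b : V} (ha : a ∈ A) (hb : b ∉ A) :
    (insert b (A.erase a)).card = A.card := by
  rw [Finset.card_insert_of_notMem (by simp [hb]), Finset.card_erase_add_one ha]

theorem tokenGraph_reachable_of_walk {a b : V} (w : G.Walk a b)
    {A B : {A : Finset V // A.card = k}} (ha : a ∈ A.1) (hb : b ∉ A.1)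
    (hB : B.1 = insert b (A.1.erase a)) : (tokenGraph G k).Reachable A B := by
  induction w generalizing A B with
  | nil => exact absurd ha hb
  | @cons a c b hac w ih =>
    by_cases hc : c ∈ A.1
    · let C : {A : Finset V // A.card = k} :=
        ⟨insert b (A.1.erase c), (card_insert_erase hc hb).trans A.2⟩
      refine (ih (B := C) hc hb rfl).trans (SimpleGraph.Adj.reachable ?_)
      have hne := hac.ne
      exact tokenGraph_adj_of_eq_insert (S := insert b ((A.1.erase a).erase c)) hac
        (by grind) (by grind) (by grind) (by grind)
    · let C : {A : Finset V // A.card = k} :=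
        ⟨insert c (A.1.erase a), (card_insert_erase ha hc).trans A.2⟩
      have hAC : (tokenGraph G k).Adj A C := tokenGraph_adj_of_eq_insert hac (by simp)
        (by simp [hc]) (Finset.insert_erase ha).symm rfl
      rcases eq_or_ne c b with rfl | hcb
      · exact (Subtype.ext hB : B = C) ▸ hAC.reachable
      · exact hAC.reachable.trans (ih (A := C) (by simp [C]) (by simp [C, hb, hcb.symm]) (by grind))

theorem tokenGraph_preconnected (hG : G.Preconnected) : (tokenGraph G k).Preconnected := by
  intro A B
  induction hd : (A.1 \ B.1).card generalizing A with
  | zero =>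
    rw [Finset.card_eq_zero, Finset.sdiff_eq_empty_iff_subset] at hd
    rw [Subtype.ext (Finset.eq_of_subset_of_card_le hd (by rw [A.2, B.2]))]
  | succ d ih =>
    have hcard := Finset.card_sdiff_comm (A.2.trans B.2.symm)
    obtain ⟨a, ha⟩ : (A.1 \ B.1).Nonempty := Finset.card_pos.1 (by omega)
    obtain ⟨b, hb⟩ : (B.1 \ A.1).Nonempty := Finset.card_pos.1 (by omega)
    rw [Finset.mem_sdiff] at ha hb
    obtain ⟨w⟩ := hG a b
    let C : {A : Finset V // A.card = k} :=
      ⟨insert b (A.1.erase a), (card_insert_erase ha.1 hb.2).trans A.2⟩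
    refine (tokenGraph_reachable_of_walk w (B := C) ha.1 hb.2 rfl).trans (ih C ?_)
    rw [Finset.insert_sdiff_of_mem _ hb.1, Finset.erase_sdiff_comm,
      Finset.card_erase_of_mem (Finset.mem_sdiff.2 ha), hd, Nat.add_sub_cancel]

/-- Taking complements of sets of vertices. -/
def tokenGraphCompl [Fintype V] (G : SimpleGraph V) (hk : k ≤ Fintype.card V) :
    tokenGraph G k ≃g tokenGraph G (Fintype.card V - k) where
  toFun A := ⟨A.1ᶜ, by rw [Finset.card_compl, A.2]⟩
  invFun A := ⟨A.1ᶜ, by rw [Finset.card_compl, A.2]; omega⟩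
  left_inv A := by simp
  right_inv A := by simp
  map_rel_iff' {A B} := by simp [tokenGraph]

end TokenGraph

theorem IsVertexConnected.preconnected_induce_pair {V : Type*} [Fintype V] [DecidableEq V]
    {G : SimpleGraph V} {c : ℕ} (hG : IsVertexConnected G c) (hc : 2 < c) (a b : V) :
    (G.induce {v : V | v ∉ ({a, b} : Finset V)}).Preconnected :=
  (hG.2 {a, b} (Finset.card_le_two.trans_lt hc)).preconnected

theorem IsVertexConnected.exists_adj_notMem {V : Type*} [Fintype V] {G : SimpleGraph V} {c : ℕ}
    (hG : IsVertexConnected G c) {b : V} {S : Finset V} (hS : S.card < c) (hb : b ∉ S) :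
    ∃ a, G.Adj b a ∧ a ∉ S := by
  classical
  obtain ⟨w, -, hw⟩ := Finset.exists_mem_notMem_of_card_lt_card
    (s := insert b S) (t := Finset.univ) (by
      have := Finset.card_insert_le b S
      have := hG.1
      rw [Finset.card_univ]
      omega)
  rw [Finset.mem_insert, not_or] at hw
  have : Nontrivial {v : V | v ∉ S} :=
    ⟨⟨b, hb⟩, ⟨w, hw.2⟩, fun h => hw.1 (Subtype.ext_iff.1 h).symm⟩
  obtain ⟨a, ha⟩ := (hG.2 S hS).preconnected.exists_adj_of_nontrivial ⟨b, hb⟩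
  exact ⟨a.1, ha, a.2⟩

theorem IsVertexConnected.exists_two_neighbors {V : Type*} [Fintype V] {G : SimpleGraph V} {c : ℕ}
    (hG : IsVertexConnected G c) (hc : 2 ≤ c) (b : V) :
    ∃ a d, G.Adj b a ∧ G.Adj b d ∧ a ≠ d := by
  obtain ⟨a, ha, -⟩ := hG.exists_adj_notMem (b := b) (S := ∅) (by simp; omega) (by simp)
  obtain ⟨d, hd, hda⟩ := hG.exists_adj_notMem (b := b) (S := {a}) (by simp; omega)
    (by simpa using ha.ne)
  exact ⟨a, d, ha, hd, fun h => hda (by simp [h])⟩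

/-! ### Labels of edges -/

section Label

variable {V W : Type*} [DecidableEq V] {G : SimpleGraph V} {Γ : SimpleGraph W} {k : ℕ}
  (τ : Γ ≃g tokenGraph G k) {x y z u v : W} {a b c : V}

/-- The label of a pair of vertices of a token graph. If they are adjacent, then it consists of the
two vertices of `G` between which a token is moved. -/
def label (x y : W) : Finset V :=
  symmDiff (τ x).1 (τ y).1

theorem adj_iff_label : Γ.Adj x y ↔ ∃ a b, G.Adj a b ∧ label τ x y = {a, b} :=
  τ.map_adj_iff.symm

theorem adj_of_label_eq (hab : G.Adj a b) (h : label τ x y = {a, b}) : Γ.Adj x y :=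
  (adj_iff_label τ).2 ⟨a, b, hab, h⟩

theorem label_comm (x y : W) : label τ x y = label τ y x :=
  symmDiff_comm _ _

theorem symmDiff_label (x y z : W) : symmDiff (label τ x y) (label τ y z) = label τ x z := by
  rw [label, label, label, symmDiff_assoc, symmDiff_symmDiff_cancel_left]

theorem mem_label : b ∈ label τ x y ↔ ¬ (b ∈ (τ x).1 ↔ b ∈ (τ y).1) := by
  rw [label, Finset.mem_symmDiff]
  tauto

theorem mem_label_trans (y : W) : b ∈ label τ x z ↔ ¬ (b ∈ label τ x y ↔ b ∈ label τ y z) := by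
  rw [← symmDiff_label τ x y z, Finset.mem_symmDiff]
  tauto

theorem label_eq_empty : label τ x y = ∅ ↔ x = y := by
  rw [label, ← Finset.bot_eq_empty, symmDiff_eq_bot, Subtype.coe_inj, τ.injective.eq_iff]

theorem label_right_inj : label τ x y = label τ x z ↔ y = z := by
  rw [← label_eq_empty τ, ← symmDiff_label τ y x z, label_comm τ y x, ← Finset.bot_eq_empty,
    symmDiff_eq_bot]

theorem label_eq_pair_of_eq_insert {S : Finset V} (hab : a ≠ b) (ha : a ∉ S) (hb : b ∉ S)
    (hx : (τ x).1 = insert a S) (hy : (τ y).1 = insert b S) : label τ x y = {a, b} := by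
  rw [label, hx, hy, symmDiff_insert_insert hab ha hb]

theorem exists_apply_coe_eq {A : Finset V} (hA : A.card = k) : ∃ x, (τ x).1 = A :=
  ⟨τ.symm ⟨A, hA⟩, by simp⟩

theorem exists_eq_insert_of_label (h : label τ x y = {a, b}) (ha : a ∈ (τ x).1) :
    ∃ S : Finset V, a ∉ S ∧ b ∉ S ∧ (τ x).1 = insert a S ∧ (τ y).1 = insert b S := by
  have hmem := fun v => mem_label τ (x := x) (y := y) (b := v)
  simp only [h, Finset.mem_insert, Finset.mem_singleton] at hmem
  have hbx : b ∉ (τ x).1 := fun hb => by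
    have hss : (τ y).1 ⊂ (τ x).1 := Finset.ssubset_iff_subset_ne.2
      ⟨fun v hv => by grind, fun he => by grind⟩
    exact (Finset.card_lt_card hss).ne ((τ y).2.trans (τ x).2.symm)
  refine ⟨(τ x).1.erase a, by simp, by simp [hbx], (Finset.insert_erase ha).symm, ?_⟩
  by_cases hby : b ∈ (τ y).1 <;> grind

theorem mem_iff_notMem_of_label (hab : a ≠ b) (h : label τ x y = {a, b}) :
    a ∈ (τ x).1 ↔ b ∉ (τ x).1 := by
  have key : ∀ {a b x y}, a ≠ b → label τ x y = {a, b} → a ∈ (τ x).1 → b ∉ (τ x).1 := by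
    intro a b x y hab h ha
    obtain ⟨S, -, hb, hx, -⟩ := exists_eq_insert_of_label τ h ha
    simp [hx, hab.symm, hb]
  refine ⟨key hab h, fun hb => ?_⟩
  by_contra ha
  have ha' := mem_label τ (x := x) (y := y) (b := a)
  have hb' := mem_label τ (x := x) (y := y) (b := b)
  simp only [h, Finset.mem_insert, Finset.mem_singleton, true_or, or_true, true_iff] at ha' hb'
  exact key hab ((label_comm τ y x).trans h) (by tauto) (by tauto)

theorem exists_adj_of_mem_label (h : Γ.Adj x y) (hb : b ∈ label τ x y) :
    ∃ a, G.Adj b a ∧ label τ x y = {b, a} := by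
  obtain ⟨p, q, hpq, hl⟩ := (adj_iff_label τ).1 h
  rw [hl, Finset.mem_insert, Finset.mem_singleton] at hb
  rcases hb with rfl | rfl
  · exact ⟨q, hpq, hl⟩
  · exact ⟨p, hpq.symm, by rw [hl, Finset.pair_comm]⟩

theorem card_label (h : Γ.Adj x y) : (label τ x y).card = 2 := by
  obtain ⟨a, b, hab, hl⟩ := (adj_iff_label τ).1 h
  rw [hl, Finset.card_pair hab.ne]

theorem adj_of_mem_label (h : Γ.Adj x y) (ha : a ∈ label τ x y) (hb : b ∈ label τ x y)
    (hab : a ≠ b) : G.Adj a b := by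
  obtain ⟨c, hac, hl⟩ := exists_adj_of_mem_label τ h ha
  obtain rfl : b = c := by simpa [hl, hab.symm] using hb
  exact hac

theorem label_eq_pair (h : Γ.Adj x y) (ha : a ∈ label τ x y) (hb : b ∈ label τ x y)
    (hab : a ≠ b) : label τ x y = {a, b} := by
  obtain ⟨c, hac, hl⟩ := exists_adj_of_mem_label τ h ha
  obtain rfl : b = c := by simpa [hl, hab.symm] using hb
  exact hl

variable (Γ) in
/-- `x y` and `u v` are opposite edges of the induced cycle `x y v u` on four vertices. -/
def OppositeEdges (x y u v : W) : Prop :=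
  Γ.Adj x y ∧ Γ.Adj y v ∧ Γ.Adj u v ∧ Γ.Adj x u ∧ x ≠ v ∧ ¬ Γ.Adj x v ∧ y ≠ u ∧ ¬ Γ.Adj y u

theorem OppositeEdges.rotate (h : OppositeEdges Γ x y u v) : OppositeEdges Γ y v x u := by
  obtain ⟨hxy, hyv, huv, hxu, hxv, hxv', hyu, hyu'⟩ := h
  exact ⟨hyv, huv.symm, hxu, hxy.symm, hyu, hyu', hxv.symm, fun h => hxv' h.symm⟩

theorem exists_common_neighbor_of_mem_label (hxy : Γ.Adj x y) (hyz : Γ.Adj y z) (hac : a ≠ c)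
    (hac' : ¬ G.Adj a c) (hxz : label τ x z = {a, c}) (ha : a ∈ label τ x y) :
    ∃ e, G.Adj a e ∧ G.Adj c e ∧ label τ x y = {a, e} := by
  obtain ⟨e, hae, hxy'⟩ := exists_adj_of_mem_label τ hxy ha
  have hce : c ≠ e := fun h => hac' (h ▸ hae)
  have hc : c ∈ label τ y z := by
    have := mem_label_trans τ (x := x) (z := z) (b := c) y
    simpa [hxz, hxy', hac.symm, hce] using this
  have he : e ∈ label τ y z := by
    have := mem_label_trans τ (x := x) (z := z) (b := e) y
    simpa [hxz, hxy', hae.ne', hce.symm] using this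
  exact ⟨e, hae, adj_of_mem_label τ hyz hc he hce, hxy'⟩

theorem OppositeEdges.disjoint_label (hG : IsC4DiamondFree G) (h : OppositeEdges Γ x y u v) :
    Disjoint (label τ x y) (label τ y v) := by
  obtain ⟨hxy, hyv, huv, hxu, hxv, hxv', hyu, -⟩ := h
  rw [Finset.disjoint_left]
  intro b hb hb'
  obtain ⟨a, hba, hl⟩ := exists_adj_of_mem_label τ hxy hb
  obtain ⟨c, hbc, hl'⟩ := exists_adj_of_mem_label τ hyv hb'
  have hac : a ≠ c := fun h => hxv ((label_right_inj τ (x := y)).1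
    (by rw [label_comm, hl, hl', h]))
  have hlxv : label τ x v = {a, c} := by
    rw [← symmDiff_label τ x y v, hl, hl', Finset.pair_comm b a, Finset.pair_comm b c]
    exact symmDiff_insert_insert hac (by simp [hba.ne']) (by simp [hbc.ne'])
  have hac' : ¬ G.Adj a c := fun h => hxv' (adj_of_label_eq τ h hlxv)
  have huniq : ∀ {e}, G.Adj a e → G.Adj c e → e = b := fun hae hce =>
    hG.eq_of_common_neighbors hac hac' hae hce hba.symm hbc.symm
  by_cases ha : a ∈ label τ x u
  · obtain ⟨e, hae, hce, he⟩ := exists_common_neighbor_of_mem_label τ hxu huv hac hac' hlxv ha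
    exact hyu ((label_right_inj τ).1 (by rw [hl, he, huniq hae hce, Finset.pair_comm]))
  · have ha' : a ∈ label τ v u := by
      have := mem_label_trans τ (x := x) (z := v) (b := a) u
      rw [label_comm τ v u]
      simpa [hlxv, ha] using this
    obtain ⟨e, hae, hce, he⟩ := exists_common_neighbor_of_mem_label τ huv.symm hxu.symm hac hac'
      ((label_comm τ v x).trans hlxv) ha'
    have h₁ := mem_iff_notMem_of_label τ hac ((label_comm τ v x).trans hlxv)
    have h₂ := mem_iff_notMem_of_label τ hae.ne he
    have h₃ := mem_iff_notMem_of_label τ hbc.ne ((label_comm τ v y).trans hl')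
    rw [huniq hae hce] at h₂
    tauto

theorem OppositeEdges.label_eq (hG : IsC4DiamondFree G) (h : OppositeEdges Γ x y u v) :
    label τ x y = label τ u v := by
  have hy := Finset.disjoint_left.1 (h.disjoint_label τ hG)
  have hx := Finset.disjoint_right.1 (h.rotate.rotate.rotate.disjoint_label τ hG)
  refine Finset.eq_of_subset_of_card_le (fun b hb => ?_)
    (by rw [card_label τ h.1, card_label τ h.2.2.1])
  have h₁ := mem_label_trans τ (x := x) (z := v) (b := b) y
  have h₂ := mem_label_trans τ (x := x) (z := v) (b := b) u
  have h₃ := hx hb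
  rw [label_comm τ u x] at h₃
  have h₄ := hy hb
  tauto

theorem oppositeEdges_of_label_eq (hxy : Γ.Adj x y) (hyv : Γ.Adj y v)
    (hd : Disjoint (label τ x y) (label τ y v)) (h : label τ x y = label τ u v) :
    OppositeEdges Γ x y u v := by
  have hxu : label τ x u = label τ y v := by
    rw [← symmDiff_label τ x v u, ← symmDiff_label τ x y v, label_comm τ v u, ← h,
      symmDiff_comm (label τ x y), symmDiff_symmDiff_cancel_right]
  have hcard : (symmDiff (label τ x y) (label τ y v)).card = 4 := by
    rw [hd.symmDiff_eq_sup, Finset.sup_eq_union, Finset.card_union_of_disjoint hd,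
      card_label τ hxy, card_label τ hyv]
  have hnot : ∀ {p q : W}, (label τ p q).card = 4 → p ≠ q ∧ ¬ Γ.Adj p q := fun {p q} h =>
    ⟨fun h' => by simp [(label_eq_empty τ).2 h'] at h, fun h' => by simp [card_label τ h'] at h⟩
  have hxv := hnot ((congrArg Finset.card (symmDiff_label τ x y v)).symm.trans hcard)
  have hyu : y ≠ u ∧ ¬ Γ.Adj y u := hnot (by
    rw [← symmDiff_label τ y x u, label_comm τ y x, hxu, hcard])
  obtain ⟨a, b, hab, hl⟩ := (adj_iff_label τ).1 hxy
  obtain ⟨c, d, hcd, hl'⟩ := (adj_iff_label τ).1 hyv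
  exact ⟨hxy, hyv, adj_of_label_eq τ hab (h ▸ hl), adj_of_label_eq τ hcd (hxu.trans hl'),
    hxv.1, hxv.2, hyu.1, hyu.2⟩

variable (Γ) in
/-- The steps that generate the equality of labels. They are taken between pairs of vertices, so
that the reversal of an edge is one of them. -/
def LabelStep (p q : W × W) : Prop :=
  OppositeEdges Γ p.1 p.2 q.1 q.2 ∨ Γ.Adj p.1 p.2 ∧ q.1 = p.2 ∧ q.2 = p.1

variable (Γ) in
/-- The edges `p` and `q` are joined by a chain of generating steps. -/
def SameLabel : W × W → W × W → Prop :=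
  Relation.ReflTransGen (LabelStep Γ)

theorem SameLabel.swap_right {p : W × W} (h : SameLabel Γ p (x, y)) (hxy : Γ.Adj x y) :
    SameLabel Γ p (y, x) :=
  h.tail (.inr ⟨hxy, rfl, rfl⟩)

theorem SameLabel.swap_left {p : W × W} (h : SameLabel Γ (x, y) p) (hxy : Γ.Adj x y) :
    SameLabel Γ (y, x) p :=
  h.head (.inr ⟨hxy.symm, rfl, rfl⟩)

theorem SameLabel.label_eq (hG : IsC4DiamondFree G) {p q : W × W} (h : SameLabel Γ p q) :
    label τ p.1 p.2 = label τ q.1 q.2 := by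
  induction h with
  | refl => rfl
  | tail _ h ih =>
    rw [ih]
    rcases h with h | ⟨-, h₁, h₂⟩
    · exact h.label_eq τ hG
    · rw [h₁, h₂, label_comm]

section InsertToken

variable {s : Finset V} {j : ℕ} {A B : {A : Finset {v : V | v ∉ s} // A.card = j}}

theorem oppositeEdges_of_tokenGraph_induce_adj (hac : G.Adj a c) (ha : a ∈ s) (hc : c ∈ s)
    (hAB : (tokenGraph (G.induce {v : V | v ∉ s}) j).Adj A B)
    (hx : (τ x).1 = insert a (A.1.map (.subtype _)))
    (hy : (τ y).1 = insert c (A.1.map (.subtype _)))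
    (hu : (τ u).1 = insert a (B.1.map (.subtype _)))
    (hv : (τ v).1 = insert c (B.1.map (.subtype _))) : OppositeEdges Γ x y u v := by
  obtain ⟨p, q, hpq, hABpq⟩ := hAB
  have hxy := label_eq_pair_of_eq_insert τ hac.ne (by simp [ha]) (by simp [hc]) hx hy
  have huv := label_eq_pair_of_eq_insert τ hac.ne (by simp [ha]) (by simp [hc]) hu hv
  have hyv : label τ y v = {p.1, q.1} := by
    have hmap : ({p.1, q.1} : Finset V) = (symmDiff A.1 B.1).map (.subtype _) := by simp [hABpq]
    ext w
    rw [hmap, mem_label, hy, hv]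
    by_cases hw : w ∈ s
    · simp [hw]
    · have hwc : w ≠ c := fun h => hw (h ▸ hc)
      simp [hw, hwc, Finset.mem_symmDiff]
      tauto
  refine oppositeEdges_of_label_eq τ (adj_of_label_eq τ hac hxy) (adj_of_label_eq τ hpq hyv) ?_
    (hxy.trans huv.symm)
  have hne : ∀ (r : {v : V | v ∉ s}), ∀ w ∈ s, r.1 ≠ w := fun r w hw h => r.2 (h ▸ hw)
  simp [hxy, hyv, hne _ a ha, hne _ c hc]

theorem sameLabel_of_tokenGraph_induce_reachable (hac : G.Adj a c) (ha : a ∈ s) (hc : c ∈ s)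
    (hAB : (tokenGraph (G.induce {v : V | v ∉ s}) j).Reachable A B)
    (hx : (τ x).1 = insert a (A.1.map (.subtype _)))
    (hy : (τ y).1 = insert c (A.1.map (.subtype _)))
    (hu : (τ u).1 = insert a (B.1.map (.subtype _)))
    (hv : (τ v).1 = insert c (B.1.map (.subtype _))) : SameLabel Γ (x, y) (u, v) := by
  obtain ⟨w⟩ := hAB
  induction w generalizing x y with
  | nil =>
    rw [τ.injective (Subtype.ext (hx.trans hu.symm)), τ.injective (Subtype.ext (hy.trans hv.symm))]
    exact .refl
  | @cons A C B hAC _ ih =>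
    have hcard : ∀ d ∈ s, (insert d (C.1.map (.subtype _))).card = k := fun d hd => by
      rw [Finset.card_insert_of_notMem (by simp [hd]), Finset.card_map, C.2, ← A.2, ← (τ x).2, hx,
        Finset.card_insert_of_notMem (by simp [ha]), Finset.card_map]
    obtain ⟨x', hx'⟩ := exists_apply_coe_eq τ (hcard a ha)
    obtain ⟨y', hy'⟩ := exists_apply_coe_eq τ (hcard c hc)
    exact (ih hx' hy' hu hv).head
      (.inl (oppositeEdges_of_tokenGraph_induce_adj τ hac ha hc hAC hx hy hx' hy'))

end InsertToken

theorem sameLabel_of_mem (hcon : (G.induce {v : V | v ∉ ({a, c} : Finset V)}).Preconnected)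
    (hac : G.Adj a c) (hxy : label τ x y = {a, c}) (huv : label τ u v = {a, c})
    (hx : a ∈ (τ x).1) (hu : a ∈ (τ u).1) : SameLabel Γ (x, y) (u, v) := by
  have key : ∀ {x y}, label τ x y = {a, c} → a ∈ (τ x).1 →
      ∃ A : Finset {v : V | v ∉ ({a, c} : Finset V)}, A.card + 1 = k ∧
        (τ x).1 = insert a (A.map (.subtype _)) ∧ (τ y).1 = insert c (A.map (.subtype _)) := by
    intro x y hxy hx
    obtain ⟨S, ha, hc, hxS, hyS⟩ := exists_eq_insert_of_label τ hxy hx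
    have hS : (S.subtype (· ∈ {v : V | v ∉ ({a, c} : Finset V)})).map (.subtype _) = S :=
      Finset.subtype_map_of_mem fun v hv => by
        simp only [Set.mem_ofPred_eq, Finset.mem_insert, Finset.mem_singleton]
        grind
    refine ⟨S.subtype _, ?_, by rw [hS, hxS], by rw [hS, hyS]⟩
    rw [← Finset.card_map, hS, ← (τ x).2, hxS, Finset.card_insert_of_notMem ha]
  obtain ⟨A, hA, hxA, hyA⟩ := key hxy hx
  obtain ⟨B, hB, huB, hvB⟩ := key huv hu
  have hBA : B.card = A.card := by omega
  exact sameLabel_of_tokenGraph_induce_reachable τ hac (by simp) (by simp)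
    (tokenGraph_preconnected hcon ⟨A, rfl⟩ ⟨B, hBA⟩) hxA hyA huB hvB

/-- On the edges of `Γ`, the relation `L` is the equality of labels. -/
def IsLabelEq (L : W × W → W × W → Prop) : Prop :=
  ∀ p q : W × W, Γ.Adj p.1 p.2 → (L p q ↔ label τ p.1 p.2 = label τ q.1 q.2)

theorem isLabelEq_sameLabel (hG : IsC4DiamondFree G)
    (hcon : ∀ a c : V, G.Adj a c →
      (G.induce {v : V | v ∉ ({a, c} : Finset V)}).Preconnected) :
    IsLabelEq τ (SameLabel Γ) := by
  rintro ⟨x, y⟩ ⟨u, v⟩ hxy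
  refine ⟨fun h => h.label_eq τ hG, fun h => ?_⟩
  obtain ⟨a, c, hac, hl⟩ := (adj_iff_label τ).1 hxy
  have hl' := h.symm.trans hl
  have hxa := (mem_label τ).1 (show a ∈ label τ x y by simp [hl])
  have hua := (mem_label τ).1 (show a ∈ label τ u v by simp [hl'])
  by_cases hx : a ∈ (τ x).1 <;> by_cases hu : a ∈ (τ u).1
  · exact sameLabel_of_mem τ (hcon a c hac) hac hl hl' hx hu
  · exact (sameLabel_of_mem τ (hcon a c hac) hac hl ((label_comm τ v u).trans hl') hx
      (by tauto)).swap_right (adj_of_label_eq τ hac hl').symm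
  · exact (sameLabel_of_mem τ (hcon a c hac) hac ((label_comm τ y x).trans hl) hl' (by tauto)
      hu).swap_left hxy.symm
  · exact (sameLabel_of_mem τ (hcon a c hac) hac ((label_comm τ y x).trans hl)
      ((label_comm τ v u).trans hl') (by tauto) (by tauto)).swap_left hxy.symm |>.swap_right
      (adj_of_label_eq τ hac hl').symm

/-! ### The vertices of the base graph -/

section Wedge

variable (Γ) (L : W × W → W × W → Prop)

/-- A path on three vertices whose edges are not consecutive edges of an induced cycle on four
vertices. In a token graph, the labels of its edges then have exactly one vertex in common, and the
wedge stands for that vertex. -/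
def IsWedge (w : W × W × W) : Prop :=
  Γ.Adj w.1 w.2.1 ∧ Γ.Adj w.2.1 w.2.2 ∧ w.1 ≠ w.2.2 ∧ ¬ ∃ u, OppositeEdges Γ w.1 w.2.1 u w.2.2

/-- The labels of two edges have exactly one vertex in common. Here and below, `L` is the equality
of labels. -/
def Meet (e f : W × W) : Prop :=
  ∃ x y z, IsWedge Γ (x, y, z) ∧ L (x, y) e ∧ L (y, z) f

/-- The labels of three edges form a triangle of the base graph. -/
def Triangular (e f g : W × W) : Prop :=
  ∃ x y z, (Γ.Adj x y ∧ Γ.Adj y z ∧ Γ.Adj x z) ∧ L (x, y) e ∧ L (y, z) f ∧ L (x, z) g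

/-- The vertex for which a wedge stands is in the label of an edge. -/
def Incident (w : W × W × W) (e : W × W) : Prop :=
  Γ.Adj e.1 e.2 ∧ (L (w.1, w.2.1) e ∨ L w.2 e ∨
    Meet Γ L (w.1, w.2.1) e ∧ Meet Γ L w.2 e ∧ ¬ Triangular Γ L (w.1, w.2.1) w.2 e)

/-- Two wedges stand for the same vertex. -/
def SameVertex (w w' : W × W × W) : Prop :=
  Incident Γ L w (w'.1, w'.2.1) ∧ Incident Γ L w w'.2

/-- Two wedges stand for adjacent vertices. -/
def AdjVertex (w w' : W × W × W) : Prop :=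
  ¬ SameVertex Γ L w w' ∧ ∃ x y, Incident Γ L w (x, y) ∧ Incident Γ L w' (x, y)

end Wedge

variable (G) in
/-- `A` and `B` are different edges of `G` with the common vertex `b`. -/
def MeetAt (A B : Finset V) (b : V) : Prop :=
  ∃ a c, G.Adj b a ∧ G.Adj b c ∧ a ≠ c ∧ A = {b, a} ∧ B = {b, c}

theorem MeetAt.eq_of_mem {A B : Finset V} (h : MeetAt G A B b) (ha : a ∈ A) (hb : a ∈ B) :
    a = b := by
  obtain ⟨a, c, -, -, hac, rfl, rfl⟩ := h
  simp only [Finset.mem_insert, Finset.mem_singleton] at ha hb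
  grind

theorem MeetAt.mem_left {A B : Finset V} (h : MeetAt G A B b) : b ∈ A := by
  obtain ⟨a, c, -, -, -, rfl, -⟩ := h
  simp

theorem MeetAt.mem_right {A B : Finset V} (h : MeetAt G A B b) : b ∈ B := by
  obtain ⟨a, c, -, -, -, -, rfl⟩ := h
  simp

/-- The vertex `b` is the common vertex of the labels of the edges of `w`. -/
def IsVertexOf (w : W × W × W) (b : V) : Prop :=
  MeetAt G (label τ w.1 w.2.1) (label τ w.2.1 w.2.2) b

theorem exists_label_eq (h : a ∈ (τ x).1 ↔ b ∉ (τ x).1) : ∃ u, label τ x u = {a, b} := by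
  have key : ∀ {a b : V}, a ∈ (τ x).1 → b ∉ (τ x).1 → ∃ u, label τ x u = {a, b} := by
    intro a b ha hb
    obtain ⟨u, hu⟩ := exists_apply_coe_eq τ ((card_insert_erase ha hb).trans (τ x).2)
    exact ⟨u, label_eq_pair_of_eq_insert τ (fun hab => hb (hab ▸ ha)) (by simp) (by simp [hb])
      (Finset.insert_erase ha).symm hu⟩
  by_cases ha : a ∈ (τ x).1
  · exact key ha (h.1 ha)
  · rw [Finset.pair_comm]
    exact key (by tauto) ha

theorem exists_oppositeEdges_of_disjoint_label (hxy : Γ.Adj x y) (hyz : Γ.Adj y z)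
    (hd : Disjoint (label τ x y) (label τ y z)) : ∃ u, OppositeEdges Γ x y u z := by
  obtain ⟨p, q, hpq, hl⟩ := (adj_iff_label τ).1 hyz
  have hp := (mem_label τ (x := x) (y := y)).not.1
    (Finset.disjoint_right.1 hd (show p ∈ label τ y z by simp [hl]))
  have hq := (mem_label τ (x := x) (y := y)).not.1
    (Finset.disjoint_right.1 hd (show q ∈ label τ y z by simp [hl]))
  have hpq' := mem_iff_notMem_of_label τ hpq.ne hl
  obtain ⟨u, hu⟩ := exists_label_eq τ (x := x) (a := p) (b := q) (by tauto)
  refine ⟨u, oppositeEdges_of_label_eq τ hxy hyz hd ?_⟩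
  rw [← symmDiff_label τ u x z, ← symmDiff_label τ x y z, label_comm τ u x, hu, hl, symmDiff_comm,
    symmDiff_symmDiff_cancel_right]

theorem isWedge_iff (hG : IsC4DiamondFree G) {w : W × W × W} :
    IsWedge Γ w ↔ ∃ b, IsVertexOf τ w b := by
  obtain ⟨x, y, z⟩ := w
  constructor
  · rintro ⟨hxy, hyz, hxz, hno⟩
    obtain ⟨b, hb, hb'⟩ := Finset.not_disjoint_iff.1
      (fun hd => hno (exists_oppositeEdges_of_disjoint_label τ hxy hyz hd))
    obtain ⟨a, hba, hla⟩ := exists_adj_of_mem_label τ hxy hb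
    obtain ⟨c, hbc, hlc⟩ := exists_adj_of_mem_label τ hyz hb'
    exact ⟨b, a, c, hba, hbc,
      fun h => hxz ((label_right_inj τ).1 (by rw [label_comm, hla, hlc, h])), hla, hlc⟩
  · rintro ⟨b, h⟩
    have ⟨a, c, hba, hbc, _, hla, hlc⟩ := h
    refine ⟨adj_of_label_eq τ hba hla, adj_of_label_eq τ hbc hlc, fun hxz => ?_, fun ⟨u, hu⟩ => ?_⟩
    · exact hba.ne' (h.eq_of_mem (a := a) (by simp [hla])
        (by rw [label_comm, ← hxz, hla]; simp))
    · exact Finset.disjoint_left.1 (hu.disjoint_label τ hG) h.mem_left h.mem_right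

section Realization

variable [Fintype V]

theorem exists_label_eq_pair (hk₁ : 1 ≤ k) {B : Finset V} (hB : k + B.card ≤ Fintype.card V + 1) :
    ∃ f : B → W, ∀ a b : B, a ≠ b → label τ (f a) (f b) = {a.1, b.1} := by
  obtain ⟨S, hS, hcard⟩ := Finset.exists_subset_card_eq (s := Bᶜ) (n := k - 1) (by
    rw [Finset.card_compl]
    omega)
  have hdisj : ∀ a : B, a.1 ∉ S := fun a h => Finset.mem_compl.1 (hS h) a.2
  have hex : ∀ a : B, ∃ x, (τ x).1 = insert a.1 S := fun a => exists_apply_coe_eq τ (by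
    rw [Finset.card_insert_of_notMem (hdisj a)]
    omega)
  choose f hf using hex
  exact ⟨f, fun a b hab => label_eq_pair_of_eq_insert τ (Subtype.coe_ne_coe.2 hab) (hdisj a)
    (hdisj b) (hf a) (hf b)⟩

theorem exists_edge_label_eq (hk₁ : 1 ≤ k) (hk : k + 1 ≤ Fintype.card V) (hab : a ≠ b) :
    ∃ x y, label τ x y = {a, b} := by
  obtain ⟨f, hf⟩ := exists_label_eq_pair τ hk₁ (B := {a, b}) (by
    rw [Finset.card_pair hab]
    omega)
  exact ⟨_, _, hf ⟨a, by simp⟩ ⟨b, by simp⟩ (by simpa using hab)⟩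

theorem exists_path_label_eq (hk₁ : 1 ≤ k) (hk : k + 2 ≤ Fintype.card V) (hab : a ≠ b)
    (hbc : b ≠ c) (hac : a ≠ c) :
    ∃ x y z, label τ x y = {b, a} ∧ label τ y z = {b, c} ∧ label τ x z = {a, c} := by
  obtain ⟨f, hf⟩ := exists_label_eq_pair τ hk₁ (B := {a, b, c})
    ((Nat.add_le_add_left Finset.card_le_three k).trans (by omega))
  refine ⟨f ⟨a, by simp⟩, f ⟨b, by simp⟩, f ⟨c, by simp⟩, ?_, ?_, ?_⟩
  · rw [hf _ _ (by simpa using hab), Finset.pair_comm]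
  · exact hf _ _ (by simpa using hbc)
  · exact hf _ _ (by simpa using hac)

theorem exists_isVertexOf (hk₁ : 1 ≤ k) (hk : k + 2 ≤ Fintype.card V) (hba : G.Adj b a)
    (hbc : G.Adj b c) (hac : a ≠ c) : ∃ w, IsVertexOf τ w b := by
  obtain ⟨x, y, z, hxy, hyz, -⟩ := exists_path_label_eq τ hk₁ hk hba.ne' hbc.ne hac
  exact ⟨(x, y, z), a, c, hba, hbc, hac, hxy, hyz⟩

end Realization

section Decoding

variable {L : W × W → W × W → Prop} {w w' : W × W × W} {e f g : W × W} {b' : V}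

theorem Triangular.symmDiff_label_eq (hL : IsLabelEq τ L) (h : Triangular Γ L e f g) :
    symmDiff (label τ e.1 e.2) (label τ f.1 f.2) = label τ g.1 g.2 := by
  obtain ⟨x, y, z, ⟨hxy, hyz, hxz⟩, he, hf, hg⟩ := h
  rw [← (hL _ _ hxy).1 he, ← (hL _ _ hyz).1 hf, ← (hL _ _ hxz).1 hg, symmDiff_label]

variable [Fintype V]

theorem meet_iff (hL : IsLabelEq τ L) (hG : IsC4DiamondFree G) (hk₁ : 1 ≤ k)
    (hk : k + 2 ≤ Fintype.card V) :
    Meet Γ L e f ↔ ∃ b, MeetAt G (label τ e.1 e.2) (label τ f.1 f.2) b := by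
  constructor
  · rintro ⟨x, y, z, hw, he, hf⟩
    obtain ⟨b, hb⟩ := (isWedge_iff τ hG).1 hw
    exact ⟨b, (hL _ _ hw.1).1 he ▸ (hL _ _ hw.2.1).1 hf ▸ hb⟩
  · rintro ⟨b, a, c, hba, hbc, hac, he, hf⟩
    obtain ⟨x, y, z, hxy, hyz, -⟩ := exists_path_label_eq τ hk₁ hk hba.ne' hbc.ne hac
    exact ⟨x, y, z, (isWedge_iff τ hG).2 ⟨b, a, c, hba, hbc, hac, hxy, hyz⟩,
      (hL _ _ (adj_of_label_eq τ hba hxy)).2 (hxy.trans he.symm),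
      (hL _ _ (adj_of_label_eq τ hbc hyz)).2 (hyz.trans hf.symm)⟩

theorem triangular_of_label_eq (hL : IsLabelEq τ L) (hk₁ : 1 ≤ k)
    (hk : k + 2 ≤ Fintype.card V) (hba : G.Adj b a) (hbc : G.Adj b c) (hac : G.Adj a c)
    (he : label τ e.1 e.2 = {b, a}) (hf : label τ f.1 f.2 = {b, c})
    (hg : label τ g.1 g.2 = {a, c}) : Triangular Γ L e f g := by
  obtain ⟨x, y, z, hxy, hyz, hxz⟩ := exists_path_label_eq τ hk₁ hk hba.ne' hbc.ne hac.ne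
  have hxy' := adj_of_label_eq τ hba hxy
  have hyz' := adj_of_label_eq τ hbc hyz
  have hxz' := adj_of_label_eq τ hac hxz
  exact ⟨x, y, z, ⟨hxy', hyz', hxz'⟩, (hL _ _ hxy').2 (hxy.trans he.symm),
    (hL _ _ hyz').2 (hyz.trans hf.symm), (hL _ _ hxz').2 (hxz.trans hg.symm)⟩

theorem Incident.mem_label (hL : IsLabelEq τ L) (hG : IsC4DiamondFree G) (hk₁ : 1 ≤ k)
    (hk : k + 2 ≤ Fintype.card V) (hw : IsVertexOf τ w b) (h : Incident Γ L w e) :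
    b ∈ label τ e.1 e.2 := by
  have hwedge := (isWedge_iff τ hG).2 ⟨b, hw⟩
  have ⟨a, c, hba, hbc, hac, hla, hlc⟩ := hw
  obtain ⟨he, h | h | ⟨hm, hm', hT⟩⟩ := h
  · exact (hL _ _ hwedge.1).1 h ▸ MeetAt.mem_left hw
  · exact (hL _ _ hwedge.2.1).1 h ▸ MeetAt.mem_right hw
  · by_contra hb
    obtain ⟨a', ha'⟩ := (meet_iff τ hL hG hk₁ hk).1 hm
    obtain ⟨c', hc'⟩ := (meet_iff τ hL hG hk₁ hk).1 hm'
    have haa' : a' = a := by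
      have hmem := ha'.mem_left
      rw [hla, Finset.mem_insert, Finset.mem_singleton] at hmem
      exact hmem.resolve_left fun h => hb (h ▸ ha'.mem_right)
    have hcc' : c' = c := by
      have hmem := hc'.mem_left
      rw [hlc, Finset.mem_insert, Finset.mem_singleton] at hmem
      exact hmem.resolve_left fun h => hb (h ▸ hc'.mem_right)
    subst haa' hcc'
    exact hT (triangular_of_label_eq τ hL hk₁ hk hba hbc
      (adj_of_mem_label τ he ha'.mem_right hc'.mem_right hac) hla hlc
      (label_eq_pair τ he ha'.mem_right hc'.mem_right hac))

theorem incident_iff (hL : IsLabelEq τ L) (hG : IsC4DiamondFree G) (hk₁ : 1 ≤ k)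
    (hk : k + 2 ≤ Fintype.card V) (hw : IsVertexOf τ w b) :
    Incident Γ L w e ↔ Γ.Adj e.1 e.2 ∧ b ∈ label τ e.1 e.2 := by
  refine ⟨fun h => ⟨h.1, h.mem_label τ hL hG hk₁ hk hw⟩, fun ⟨he, hb⟩ => ⟨he, ?_⟩⟩
  have hwedge := (isWedge_iff τ hG).2 ⟨b, hw⟩
  obtain ⟨a, c, hba, hbc, -, hla, hlc⟩ := hw
  obtain ⟨d, hbd, hld⟩ := exists_adj_of_mem_label τ he hb
  rw [hL _ _ hwedge.1, hL _ _ hwedge.2.1, meet_iff τ hL hG hk₁ hk, meet_iff τ hL hG hk₁ hk]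
  by_cases hda : a = d
  · exact .inl (by rw [hla, hld, hda])
  by_cases hdc : c = d
  · exact .inr (.inl (by rw [hlc, hld, hdc]))
  refine .inr (.inr ⟨⟨b, a, d, hba, hbd, hda, hla, hld⟩, ⟨b, c, d, hbc, hbd, hdc, hlc, hld⟩,
    fun hT => ?_⟩)
  have hsymm := hT.symmDiff_label_eq τ hL
  rw [← hsymm, hla, hlc] at hb
  simp [Finset.mem_symmDiff] at hb

theorem sameVertex_iff (hL : IsLabelEq τ L) (hG : IsC4DiamondFree G) (hk₁ : 1 ≤ k)
    (hk : k + 2 ≤ Fintype.card V) (hw : IsVertexOf τ w b) (hw' : IsVertexOf τ w' b') :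
    SameVertex Γ L w w' ↔ b = b' := by
  have hwedge := (isWedge_iff τ hG).2 ⟨b', hw'⟩
  rw [SameVertex, incident_iff τ hL hG hk₁ hk hw, incident_iff τ hL hG hk₁ hk hw]
  refine ⟨fun h => MeetAt.eq_of_mem hw' h.1.2 h.2.2, ?_⟩
  rintro rfl
  exact ⟨⟨hwedge.1, MeetAt.mem_left hw'⟩, hwedge.2.1, MeetAt.mem_right hw'⟩

theorem adjVertex_iff (hL : IsLabelEq τ L) (hG : IsC4DiamondFree G) (hk₁ : 1 ≤ k)
    (hk : k + 2 ≤ Fintype.card V) (hw : IsVertexOf τ w b) (hw' : IsVertexOf τ w' b') :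
    AdjVertex Γ L w w' ↔ G.Adj b b' := by
  simp only [AdjVertex, sameVertex_iff τ hL hG hk₁ hk hw hw', incident_iff τ hL hG hk₁ hk hw,
    incident_iff τ hL hG hk₁ hk hw']
  constructor
  · rintro ⟨hne, x, y, ⟨hxy, hb⟩, -, hb'⟩
    exact adj_of_mem_label τ hxy hb hb' hne
  · intro h
    obtain ⟨x, y, hl⟩ := exists_edge_label_eq τ hk₁ (by omega) h.ne
    have hxy := adj_of_label_eq τ h hl
    exact ⟨h.ne, x, y, ⟨hxy, by simp [hl]⟩, hxy, by simp [hl]⟩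

variable (Γ L) in
/-- Among the wedges that stand for the same vertex, the wedge `w` has the least `code`. It is thus
the chosen representative of that vertex. -/
def IsRep (code : W × W × W → ℕ) (w : W × W × W) : Prop :=
  IsWedge Γ w ∧ ∀ x y z, IsWedge Γ (x, y, z) → SameVertex Γ L w (x, y, z) →
    code w ≤ code (x, y, z)

theorem exists_isRep_equiv (hL : IsLabelEq τ L) (hG : IsC4DiamondFree G) (hk₁ : 1 ≤ k)
    (hk : k + 2 ≤ Fintype.card V) (hdeg : ∀ b, ∃ a c, G.Adj b a ∧ G.Adj b c ∧ a ≠ c)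
    {code : W × W × W → ℕ} (hcode : code.Injective) :
    ∃ e : {w // IsRep Γ L code w} ≃ V,
      ∀ w w', AdjVertex Γ L w.1 w'.1 ↔ G.Adj (e w) (e w') := by
  have hvertex : ∀ w : {w // IsRep Γ L code w}, ∃ b, IsVertexOf τ w.1 b :=
    fun w => (isWedge_iff τ hG).1 w.2.1
  choose e he using hvertex
  have hle : ∀ w w', e w = e w' → code w.1 ≤ code w'.1 := fun w w' h =>
    w.2.2 _ _ _ w'.2.1 ((sameVertex_iff τ hL hG hk₁ hk (he w) (he w')).2 h)
  have hinj : e.Injective := fun w w' h =>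
    Subtype.ext (hcode (le_antisymm (hle w w' h) (hle w' w h.symm)))
  have hsurj : e.Surjective := fun b => by
    obtain ⟨a, c, hba, hbc, hac⟩ := hdeg b
    obtain ⟨w, hw, hmin⟩ := WellFounded.has_min (measure code).wf {w | IsVertexOf τ w b}
      (exists_isVertexOf τ hk₁ hk hba hbc hac)
    have hrep : IsRep Γ L code w := ⟨(isWedge_iff τ hG).2 ⟨b, hw⟩, fun x y z hwedge hsame => by
      obtain ⟨b', hb'⟩ := (isWedge_iff τ hG).1 hwedge
      rw [← (sameVertex_iff τ hL hG hk₁ hk hw hb').1 hsame] at hb'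
      exact not_lt.1 (hmin _ hb')⟩
    exact ⟨⟨w, hrep⟩, (sameVertex_iff τ hL hG hk₁ hk (he ⟨w, hrep⟩) hw).1
      ((sameVertex_iff τ hL hG hk₁ hk hw hw).2 rfl)⟩
  exact ⟨.ofBijective e ⟨hinj, hsurj⟩, fun w w' => adjVertex_iff τ hL hG hk₁ hk (he w) (he w')⟩

end Decoding

end Label

open Classical in
theorem exists_equiv_fin_card_lt {α : Type*} [Fintype α] (P : α → Prop) {f : α → ℕ}
    (hf : f.Injective) :
    ∃ e : {a // P a} ≃ Fin (Finset.univ.filter P).card,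
      ∀ a, (e a : ℕ) = (Finset.univ.filter fun x => P x ∧ f x < f a).card := by
  have hlt : ∀ a, P a → ∀ s : Finset α, (∀ x, P x ∧ f x ≤ f a → x ∈ s) →
      (Finset.univ.filter fun x => P x ∧ f x < f a).card < s.card := fun a ha s hs =>
    Finset.card_lt_card (Finset.ssubset_iff.2 ⟨a, by simp, fun x hx => hs x (by
      simp only [Finset.mem_insert, Finset.mem_filter, Finset.mem_univ, true_and] at hx
      rcases hx with rfl | hx
      exacts [⟨ha, le_rfl⟩, ⟨hx.1, hx.2.le⟩])⟩)
  let e : {a // P a} → Fin (Finset.univ.filter P).card := fun a => ⟨_, hlt a a.2 _ (by simp_all)⟩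
  have hmono : ∀ a b : {a // P a}, f a < f b → e a < e b := fun a b hab =>
    hlt a a.2 _ fun x hx => by simpa using ⟨hx.1, hx.2.trans_lt hab⟩
  have hinj : e.Injective := fun a b hab => Subtype.ext (hf (by
    by_contra hne
    rcases lt_or_gt_of_ne hne with h | h
    exacts [(hmono a b h).ne hab, (hmono b a h).ne' hab]))
  exact ⟨.ofBijective e ((Fintype.bijective_iff_injective_and_card e).2
    ⟨hinj, by simp [Fintype.card_subtype]⟩), fun _ => rfl⟩

theorem reflTransGen_insert_iff {α : Type*} {r r' : α → α → Prop} {p q : α}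
    (hr' : ∀ a b, r' a b ↔ r a b ∨ a = p ∧ b = q) {a b : α} :
    Relation.ReflTransGen r' a b ↔ Relation.ReflTransGen r a b ∨
      Relation.ReflTransGen r a p ∧ Relation.ReflTransGen r q b := by
  have hmono : ∀ {a b}, Relation.ReflTransGen r a b → Relation.ReflTransGen r' a b :=
    Relation.ReflTransGen.mono (fun a b hab => (hr' a b).2 (.inl hab)) _ _
  refine ⟨fun h => ?_, ?_⟩
  · induction h with
    | refl => exact .inl .refl
    | @tail b c _ hbc ih =>
      rcases (hr' b c).1 hbc with hbc | ⟨rfl, rfl⟩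
      · exact ih.imp (·.tail hbc) fun h => ⟨h.1, h.2.tail hbc⟩
      · exact .inr ⟨ih.elim id And.left, .refl⟩
  · rintro (h | ⟨h, h'⟩)
    · exact hmono h
    · exact ((hmono h).tail ((hr' p q).2 (.inr ⟨rfl, rfl⟩))).trans (hmono h')

theorem foldl_invariant {α β : Type*} {f : α → β → α} {P : Set β → α → Prop} {l : List β}
    (hl : ∀ b, b ∈ l) {a : α} (h₀ : P ∅ a) (h : ∀ D a b, P D a → P (insert b D) (f a b)) :
    P Set.univ (l.foldl f a) := by
  have key : ∀ (l : List β) D a, P D a → P (D ∪ {b | b ∈ l}) (l.foldl f a) := by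
    intro l
    induction l with
    | nil => simp
    | cons b l ih =>
      intro D a hD
      have hset : D ∪ {c | c ∈ b :: l} = insert b D ∪ {c | c ∈ l} := by
        ext c
        simp only [Set.mem_union, Set.mem_ofPred_eq, List.mem_cons, Set.mem_insert_iff]
        tauto
      rw [hset, List.foldl_cons]
      exact ih _ _ (h D a b hD)
  simpa [hl] using key l ∅ a h₀

theorem foldl_product {α β γ : Type*} (f : γ → α × β → γ) (l : List α) (l' : List β) (c : γ) :
    (l ×ˢ l').foldl f c = l.foldl (fun c a => l'.foldl (fun c b => f c (a, b)) c) c := by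
  simp [SProd.sprod, List.product, List.foldl_flatMap, List.foldl_map]

namespace RAM

/-! ### Executing programs -/

/-- Started in `s`, the program `P` halts after at most `T` steps in a state that satisfies `Q`, and
it leaves the registers below `b` as they were. -/
def Exec (P : Prog) (b T : ℕ) (s : State) (Q : State → Prop) : Prop :=
  ∃ s' t, Runs P s s' t ∧ t ≤ T ∧ (∀ r < b, s'.reg r = s.reg r) ∧ Q s'

theorem setReg_reg (s : State) (x v r : ℕ) :
    (s.setReg x v).reg r = if r = x then v else s.reg r := by
  simp [State.setReg, Function.update_apply]

@[simp]
theorem setReg_arr (s : State) (x v : ℕ) : (s.setReg x v).arr = s.arr := rfl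

theorem setReg_reg_of_lt {b x r : ℕ} (s : State) (v : ℕ) (hx : b ≤ x) (hr : r < b) :
    (s.setReg x v).reg r = s.reg r := by
  rw [setReg_reg, if_neg (by omega)]

section Exec

variable {P P' : Prog} {b b' x y z T T' : ℕ} {s : State} {Q Q' : State → Prop}

theorem Exec.mono (h : Exec P b T s Q) (hb : b' ≤ b) (hT : T ≤ T')
    (hQ : ∀ s', (∀ r < b, s'.reg r = s.reg r) → Q s' → Q' s') : Exec P b' T' s Q' := by
  obtain ⟨s', t, hrun, ht, hframe, hs'⟩ := h
  exact ⟨s', t, hrun, ht.trans hT, fun r hr => hframe r (hr.trans_le hb), hQ s' hframe hs'⟩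

theorem exec_seq (h : Exec P b T s fun s₁ => Exec P' b T' s₁ Q) :
    Exec (.seq P P') b (T + T') s Q := by
  obtain ⟨s₁, t, hrun, ht, hframe, s₂, t', hrun', ht', hframe', hs₂⟩ := h
  exact ⟨s₂, t + t', .seq hrun hrun', add_le_add ht ht',
    fun r hr => (hframe' r hr).trans (hframe r hr), hs₂⟩

theorem exec_const {c : ℕ} (hx : b ≤ x) (h : Q (s.setReg x c)) : Exec (.const x c) b 1 s Q :=
  ⟨_, _, .const x c s, le_rfl, fun _ => setReg_reg_of_lt s _ hx, h⟩

theorem exec_copy (hx : b ≤ x) (h : Q (s.setReg x (s.reg y))) : Exec (.copy x y) b 1 s Q :=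
  ⟨_, _, .copy x y s, le_rfl, fun _ => setReg_reg_of_lt s _ hx, h⟩

theorem exec_add (hx : b ≤ x) (h : Q (s.setReg x (s.reg y + s.reg z))) :
    Exec (.add x y z) b 1 s Q :=
  ⟨_, _, .add x y z s, le_rfl, fun _ => setReg_reg_of_lt s _ hx, h⟩

theorem exec_sub (hx : b ≤ x) (h : Q (s.setReg x (s.reg y - s.reg z))) :
    Exec (.sub x y z) b 1 s Q :=
  ⟨_, _, .sub x y z s, le_rfl, fun _ => setReg_reg_of_lt s _ hx, h⟩

theorem exec_load {a : ℕ} (hx : b ≤ x) (h : Q (s.setReg x (s.arr a (s.reg y)))) :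
    Exec (.load x a y) b 1 s Q :=
  ⟨_, _, .load x a y s, le_rfl, fun _ => setReg_reg_of_lt s _ hx, h⟩

theorem exec_store {a : ℕ} (h : Q (s.setArr a (s.reg x) (s.reg y))) : Exec (.store a x y) b 1 s Q :=
  ⟨_, _, .store a x y s, le_rfl, fun _ _ => rfl, h⟩

theorem exec_cond (h : s.reg x ≠ 0 → Exec P b T s Q) (h' : s.reg x = 0 → Exec P' b T s Q) :
    Exec (.cond x P P') b (T + 1) s Q := by
  by_cases hx : s.reg x = 0
  · obtain ⟨s', t, hrun, ht, hs'⟩ := h' hx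
    exact ⟨s', t + 1, .cond_false hx hrun, by omega, hs'⟩
  · obtain ⟨s', t, hrun, ht, hs'⟩ := h hx
    exact ⟨s', t + 1, .cond_true hx hrun, by omega, hs'⟩

theorem exec_loop {I : ℕ → State → Prop} (h0 : I 0 s)
    (hbody : ∀ i s₁, (∀ r < b, s₁.reg r = s.reg r) → s₁.reg x + i = s.reg x → s₁.reg x ≠ 0 →
      I i s₁ → Exec P b T s₁ fun s₂ => s₂.reg x + 1 = s₁.reg x ∧ I (i + 1) s₂) :
    Exec (.loop x P) b (s.reg x * (T + 1) + 1) s (I (s.reg x)) := by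
  suffices key : ∀ d i s₁, s₁.reg x = d → d + i = s.reg x → (∀ r < b, s₁.reg r = s.reg r) →
      I i s₁ → Exec (.loop x P) b (d * (T + 1) + 1) s₁ (I (s.reg x)) from
    key _ 0 s rfl rfl (fun _ _ => rfl) h0
  intro d
  induction d with
  | zero =>
    intro i s₁ hx hi _ hI
    exact ⟨s₁, 1, .loop_done hx, by omega, fun _ _ => rfl, by rwa [← hi, Nat.zero_add]⟩
  | succ d ih =>
    intro i s₁ hx hi hs₁ hI
    obtain ⟨s₂, t, hrun, ht, hframe, hx₂, hI₂⟩ := hbody i s₁ hs₁ (by omega) (by omega) hI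
    obtain ⟨s₃, t', hrun', ht', hframe', hI₃⟩ := ih (i + 1) s₂ (by omega) (by omega)
      (fun r hr => (hframe r hr).trans (hs₁ r hr)) hI₂
    exact ⟨s₃, t + t' + 1, .loop_step (by omega) hrun hrun', by rw [Nat.succ_mul]; omega,
      fun r hr => (hframe' r hr).trans (hframe r hr), hI₃⟩

end Exec

/-- Run `body` with register `b` going through the numbers below the content of register `0`. The
registers `b + 1` and `b + 2` hold the number of remaining rounds and the constant `1`. -/
def forProg (b : ℕ) (body : Prog) : Prog :=
  .seq (.copy (b + 1) 0) <| .seq (.const (b + 2) 1) <| .seq (.const b 0) <|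
    .loop (b + 1) <| .seq body <| .seq (.add b b (b + 2)) (.sub (b + 1) (b + 1) (b + 2))

theorem exec_forProg {body : Prog} {b T : ℕ} {s : State} {I : ℕ → ℕ → (ℕ → ℕ → ℕ) → Prop}
    (h0 : I 0 (s.reg (b + 3)) s.arr)
    (hbody : ∀ i < s.reg 0, ∀ s₁, (∀ r < b, s₁.reg r = s.reg r) → s₁.reg b = i →
      I i (s₁.reg (b + 3)) s₁.arr →
        Exec body (b + 3) T s₁ fun s₂ => I (i + 1) (s₂.reg (b + 3)) s₂.arr) :
    Exec (forProg b body) b (s.reg 0 * (T + 3) + 4) s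
      fun s' => I (s.reg 0) (s'.reg (b + 3)) s'.arr := by
  have hstart : ∀ r < b, (((s.setReg (b + 1) (s.reg 0)).setReg (b + 2) 1).setReg b 0).reg r =
      s.reg r := fun r hr => by simp only [setReg_reg]; grind
  have hloop := exec_loop (b := b) (x := b + 1) (T := T + 2)
    (P := .seq body <| .seq (.add b b (b + 2)) (.sub (b + 1) (b + 1) (b + 2)))
    (s := ((s.setReg (b + 1) (s.reg 0)).setReg (b + 2) 1).setReg b 0)
    (I := fun i s' => s'.reg b = i ∧ s'.reg (b + 2) = 1 ∧ I i (s'.reg (b + 3)) s'.arr)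
    (by simpa [setReg_reg] using h0) ?_
  · refine (exec_seq (exec_copy (by omega) (exec_seq (exec_const (by omega)
      (exec_seq (exec_const le_rfl (hloop.mono le_rfl le_rfl fun s' _ hI => ?_))))))).mono
      le_rfl ?_ fun _ _ h => h
    · simpa [setReg_reg] using hI.2.2
    · grind [setReg_reg]
  · rintro i s₁ hs₁ hi hpos ⟨hb, hone, hI⟩
    have hlt : i < s.reg 0 := by grind [setReg_reg]
    refine exec_seq ((hbody i hlt s₁ (fun r hr => (hs₁ r hr).trans (hstart r hr)) hb hI).mono
      (by omega) le_rfl fun s₂ hs₂ hI₂ => exec_seq (exec_add le_rfl (exec_sub (by omega) ?_)))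
    have e₀ := hs₂ b (by omega)
    have e₁ := hs₂ (b + 1) (by omega)
    have e₂ := hs₂ (b + 2) (by omega)
    refine ⟨?_, ?_, ?_, by simpa [setReg_reg] using hI₂⟩ <;> grind [setReg_reg]

/-! ### Functions computable in polynomial time -/

/-- The contents `m a i` of the cells `i` of the arrays `a`. -/
abbrev Memory : Type := ℕ → ℕ → ℕ

/-- In the state `s`, whose registers from `b` on are free for use, register `0` contains `n`, the
arrays contain `m`, and register `ρ i` contains the index variable `x i`. -/
structure Represents {ι : Type} (ρ : ι → ℕ) (b : ℕ) {n : ℕ} (x : ι → Fin n) (m : Memory)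
    (s : State) : Prop where
  pos : 0 < b
  lt : ∀ i, ρ i < b
  size : s.reg 0 = n
  var : ∀ i, s.reg (ρ i) = x i
  arr : s.arr = m

/-- The function `g` of a size `n`, of indices `x i < n` and of the arrays is computable in time
polynomial in `n`, by a program that leaves the arrays as they are. The program depends on the
registers `ρ` which hold the indices and on the first free register `b`, which receives the
result. -/
def Computes {ι : Type} (g : ∀ n, (ι → Fin n) → Memory → ℕ) : Prop :=
  ∃ (P : (ι → ℕ) → ℕ → Prog) (p : Polynomial ℕ), ∀ ρ b n x m s, Represents ρ b x m s →
    Exec (P ρ b) b (p.eval n) s fun s' => s'.arr = m ∧ s'.reg b = g n x m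

/-- The predicate `φ` is decidable in polynomial time, in the sense of `Computes`. -/
def Decides {ι : Type} (φ : ∀ n, (ι → Fin n) → Memory → Prop) : Prop :=
  ∃ g : ∀ n, (ι → Fin n) → Memory → ℕ, Computes g ∧ ∀ n x m, g n x m ≠ 0 ↔ φ n x m

/-- The update `f` of the arrays can be performed in time polynomial in `n`. -/
def Transforms {ι : Type} (f : ∀ n, (ι → Fin n) → Memory → Memory) : Prop :=
  ∃ (P : (ι → ℕ) → ℕ → Prog) (p : Polynomial ℕ), ∀ ρ b n x m s, Represents ρ b x m s →
    Exec (P ρ b) b (p.eval n) s fun s' => s'.arr = f n x m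

section Closure

variable {ι : Type} {ρ : ι → ℕ} {b b' n : ℕ} {x : ι → Fin n} {m m' : Memory} {s s' : State}

theorem Represents.of_frame (h : Represents ρ b x m s) (hb : b ≤ b')
    (hs : ∀ r < b, s'.reg r = s.reg r) (hm : s'.arr = m') : Represents ρ b' x m' s' where
  pos := h.pos.trans_le hb
  lt i := (h.lt i).trans_le hb
  size := (hs 0 h.pos).trans h.size
  var i := (hs _ (h.lt i)).trans (h.var i)
  arr := hm

theorem Represents.cons (h : Represents ρ b x m s) {i : Fin n} (hi : s.reg b = i) (hb : b < b') :
    Represents (fun o : Option ι => o.elim b ρ) b' (fun o : Option ι => o.elim i x) m s where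
  pos := h.pos.trans hb
  lt o := by cases o <;> simp [hb, (h.lt _).trans hb]
  size := h.size
  var o := by cases o <;> simp [hi, h.var]
  arr := h.arr

theorem take_finRange_succ (i : Fin n) :
    (List.finRange n).take (i + 1) = (List.finRange n).take i ++ [i] := by
  simp [List.take_add_one]

theorem Represents.exec_forProg (h : Represents ρ b x m s) {body : Prog} {T : ℕ}
    {I : List (Fin n) → ℕ → Memory → Prop} (h0 : I [] (s.reg (b + 3)) m)
    (hbody : ∀ l i m' s₁,
      Represents (fun o : Option ι => o.elim b ρ) (b + 3) (fun o : Option ι => o.elim i x) m' s₁ →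
      I l (s₁.reg (b + 3)) m' →
      Exec body (b + 3) T s₁ fun s₂ => I (l ++ [i]) (s₂.reg (b + 3)) s₂.arr) :
    Exec (forProg b body) b (n * (T + 3) + 4) s
      fun s' => I (List.finRange n) (s'.reg (b + 3)) s'.arr := by
  have hfor := RAM.exec_forProg (b := b) (T := T) (s := s) (body := body)
    (I := fun j => I ((List.finRange n).take j)) (by simpa [h.arr] using h0)
    fun j hj s₁ hs₁ hb hI => by
      lift j to Fin n using h.size ▸ hj
      rw [take_finRange_succ]
      exact hbody _ j _ s₁ ((h.of_frame le_rfl hs₁ rfl).cons hb (by omega)) hI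
  rw [h.size] at hfor
  simpa [List.take_of_length_le] using hfor

variable {g g' : ∀ n, (ι → Fin n) → Memory → ℕ} {φ ψ : ∀ n, (ι → Fin n) → Memory → Prop}
  {f f' : ∀ n, (ι → Fin n) → Memory → Memory}

namespace Computes

theorem const (c : ℕ) : Computes fun n (_ : ι → Fin n) _ => c :=
  ⟨fun _ b => .const b c, 1, fun ρ b n x m s h => by
    simpa using exec_const le_rfl (by simp [h.arr, setReg_reg])⟩

theorem size : Computes fun n (_ : ι → Fin n) _ => n :=
  ⟨fun _ b => .copy b 0, 1, fun ρ b n x m s h => by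
    simpa using exec_copy le_rfl (by simp [h.arr, h.size, setReg_reg])⟩

theorem var (i : ι) : Computes fun n (x : ι → Fin n) _ => (x i : ℕ) :=
  ⟨fun ρ b => .copy b (ρ i), 1, fun ρ b n x m s h => by
    simpa using exec_copy le_rfl (by simp [h.arr, h.var, setReg_reg])⟩

theorem cell (a : ℕ) (hg : Computes g) : Computes fun n x m => m a (g n x m) := by
  obtain ⟨P, p, hP⟩ := hg
  refine ⟨fun ρ b => .seq (P ρ b) (.load b a b), p + 1, fun ρ b n x m s h => ?_⟩
  simpa using exec_seq ((hP ρ b n x m s h).mono le_rfl le_rfl fun s₁ _ ⟨harr, hval⟩ =>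
    exec_load le_rfl (by simp [setReg_reg, harr, hval]))

theorem binary {F : ℕ → ℕ → ℕ} {op : ℕ → ℕ → ℕ → Prog}
    (hop : ∀ b y z s Q, Q (s.setReg b (F (s.reg y) (s.reg z))) → Exec (op b y z) b 1 s Q)
    (hg : Computes g) (hg' : Computes g') : Computes fun n x m => F (g n x m) (g' n x m) := by
  obtain ⟨P, p, hP⟩ := hg
  obtain ⟨P', p', hP'⟩ := hg'
  refine ⟨fun ρ b => .seq (P ρ b) (.seq (P' ρ (b + 1)) (op b b (b + 1))), p + (p' + 1),
    fun ρ b n x m s h => ?_⟩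
  simpa using exec_seq ((hP ρ b n x m s h).mono le_rfl le_rfl fun s₁ hs₁ ⟨harr, hval⟩ =>
    exec_seq ((hP' ρ (b + 1) n x m s₁ (h.of_frame (by omega) hs₁ harr)).mono (by omega) le_rfl
      fun s₂ hs₂ ⟨harr', hval'⟩ => hop _ _ _ _ _
        (by simp [setReg_reg, harr', hval', hs₂ b (by omega), hval])))

theorem add (hg : Computes g) (hg' : Computes g') :
    Computes fun n x m => g n x m + g' n x m :=
  binary (fun _ _ _ _ _ => exec_add le_rfl) hg hg'

theorem sub (hg : Computes g) (hg' : Computes g') :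
    Computes fun n x m => g n x m - g' n x m :=
  binary (fun _ _ _ _ _ => exec_sub le_rfl) hg hg'

theorem sum {g : ∀ n, (ι → Fin n) → Fin n → Memory → ℕ}
    (hg : Computes fun n (x : Option ι → Fin n) m => g n (fun i => x (some i)) (x none) m) :
    Computes fun n x m => ∑ i, g n x i m := by
  obtain ⟨P, p, hP⟩ := hg
  refine ⟨fun ρ b => .seq (.const (b + 3) 0) <| .seq (forProg b <|
    .seq (P (fun o => o.elim b ρ) (b + 4)) (.add (b + 3) (b + 3) (b + 4))) (.copy b (b + 3)),
    1 + ((.X * ((p + 1) + 3) + 4) + 1), fun ρ b n x m s h => ?_⟩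
  have hinit := h.of_frame le_rfl (fun _ => setReg_reg_of_lt s 0 (show b ≤ b + 3 by omega)) h.arr
  have hfor := hinit.exec_forProg (T := p.eval n + 1)
    (body := .seq (P (fun o => o.elim b ρ) (b + 4)) (.add (b + 3) (b + 3) (b + 4)))
    (I := fun l acc m' => m' = m ∧ acc = (l.map fun i => g n x i m).sum)
    (by simp [setReg_reg]) fun l i m' s₁ h₁ ⟨hm', hacc⟩ =>
      exec_seq ((hP _ (b + 4) n _ m' s₁ (h₁.of_frame (by omega) (fun _ _ => rfl) h₁.arr)).mono
        (by omega) le_rfl fun s₂ hs₂ ⟨harr, hval⟩ => exec_add le_rfl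
          (by simp [setReg_reg, harr, hval, hm', hs₂ (b + 3) (by omega), hacc]))
  simpa [Fin.sum_univ_def] using exec_seq (exec_const (by omega) (exec_seq (hfor.mono le_rfl le_rfl
    fun s' _ ⟨harr, hval⟩ => exec_copy le_rfl (by simp [setReg_reg, harr, hval]))))

theorem reindex {κ : Type} (hg : Computes g) (σ : ι → κ) :
    Computes fun n (x : κ → Fin n) m => g n (fun i => x (σ i)) m := by
  obtain ⟨P, p, hP⟩ := hg
  exact ⟨fun ρ => P fun i => ρ (σ i), p, fun ρ b n x m s h => hP _ b n _ m s
    ⟨h.pos, fun i => h.lt (σ i), h.size, fun i => h.var (σ i), h.arr⟩⟩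

theorem size_mul (hg : Computes g) : Computes fun n x m => n * g n x m := by
  simpa using (hg.reindex some).sum (g := fun n x _ m => g n x m)

theorem ite [∀ n x m, Decidable (φ n x m)] (hφ : Decides φ) (hg : Computes g)
    (hg' : Computes g') : Computes fun n x m => if φ n x m then g n x m else g' n x m := by
  obtain ⟨d, ⟨P, p, hP⟩, hd⟩ := hφ
  obtain ⟨P₁, p₁, hP₁⟩ := hg
  obtain ⟨P₂, p₂, hP₂⟩ := hg'
  refine ⟨fun ρ b => .seq (P ρ b) (.cond b (P₁ ρ b) (P₂ ρ b)), p + (p₁ + p₂ + 1),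
    fun ρ b n x m s h => ?_⟩
  simp only [Polynomial.eval_add, Polynomial.eval_one]
  refine exec_seq ((hP ρ b n x m s h).mono le_rfl le_rfl fun s₁ hs₁ ⟨harr, hval⟩ => ?_)
  have h₁ := h.of_frame le_rfl hs₁ harr
  refine exec_cond (fun hb => ?_) fun hb => ?_
  · rw [if_pos ((hd n x m).1 (hval ▸ hb))]
    exact (hP₁ ρ b n x m s₁ h₁).mono le_rfl (by omega) fun _ _ h => h
  · rw [if_neg fun hφ => (hd n x m).2 hφ (hval ▸ hb)]
    exact (hP₂ ρ b n x m s₁ h₁).mono le_rfl (by omega) fun _ _ h => h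

end Computes

namespace Decides

theorem ne_zero (hg : Computes g) : Decides fun n x m => g n x m ≠ 0 :=
  ⟨g, hg, fun _ _ _ => Iff.rfl⟩

theorem not (hφ : Decides φ) : Decides fun n x m => ¬ φ n x m := by
  obtain ⟨d, hd, hdφ⟩ := hφ
  exact ⟨_, .sub (.const 1) hd, fun n x m => by simp only [← hdφ]; omega⟩

theorem or (hφ : Decides φ) (hψ : Decides ψ) : Decides fun n x m => φ n x m ∨ ψ n x m := by
  obtain ⟨d, hd, hdφ⟩ := hφ
  obtain ⟨e, he, heψ⟩ := hψ
  exact ⟨_, .add hd he, fun n x m => by simp only [← hdφ, ← heψ]; omega⟩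

theorem and (hφ : Decides φ) (hψ : Decides ψ) : Decides fun n x m => φ n x m ∧ ψ n x m := by
  simpa only [not_or, not_not] using (hφ.not.or hψ.not).not

theorem imp (hφ : Decides φ) (hψ : Decides ψ) : Decides fun n x m => φ n x m → ψ n x m := by
  simpa only [imp_iff_not_or] using hφ.not.or hψ

theorem exists_index {φ : ∀ n, (ι → Fin n) → Fin n → Memory → Prop}
    (hφ : Decides fun n (x : Option ι → Fin n) m => φ n (fun i => x (some i)) (x none) m) :
    Decides fun n x m => ∃ i, φ n x i m := by
  obtain ⟨d, hd, hdφ⟩ := hφ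
  refine ⟨_, .sum (g := fun n x i m => d n (fun o => o.elim i x) m) ?_, fun n x m => ?_⟩
  · convert hd using 4 with n x m
    ext o
    cases o <;> rfl
  · simpa using exists_congr fun i => hdφ n (fun o => o.elim i x) m

theorem forall_index {φ : ∀ n, (ι → Fin n) → Fin n → Memory → Prop}
    (hφ : Decides fun n (x : Option ι → Fin n) m => φ n (fun i => x (some i)) (x none) m) :
    Decides fun n x m => ∀ i, φ n x i m := by
  simpa only [not_exists, not_not] using
    (exists_index (φ := fun n x i m => ¬ φ n x i m) hφ.not).not

theorem lt (hg : Computes g) (hg' : Computes g') : Decides fun n x m => g n x m < g' n x m :=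
  ⟨_, .sub hg' hg, fun _ _ _ => Nat.sub_ne_zero_iff_lt⟩

theorem le (hg : Computes g) (hg' : Computes g') : Decides fun n x m => g n x m ≤ g' n x m := by
  simpa only [not_lt] using (lt hg' hg).not

theorem var_eq (i j : ι) : Decides fun n (x : ι → Fin n) _ => x i = x j := by
  have h := ((lt (.var i) (.var j)).or (lt (.var j) (.var i))).not (ι := ι)
  simpa only [not_or, not_lt, Fin.val_fin_le, ← le_antisymm_iff, @eq_comm _ (_ : Fin _)] using h

end Decides

theorem Computes.card_mul {φ : ∀ n, (ι → Fin n) → Fin n × Fin n × Fin n → Memory → Prop}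
    [∀ n x w m, Decidable (φ n x w m)]
    (hφ : Decides fun n (x : Option (Option (Option ι)) → Fin n) m =>
      φ n (fun i => x (some (some (some i)))) (x (some (some none)), x (some none), x none) m)
    (hg : Computes g) :
    Computes fun n x m => (Finset.univ.filter fun w => φ n x w m).card * g n x m := by
  have h := sum (sum (sum (ite hφ (hg.reindex fun i => some (some (some i))) (const 0)))
    (g := fun n x j m => ∑ k, if φ n (fun i => x (some i)) (x none, j, k) m then
      g n (fun i => x (some i)) m else 0))
    (g := fun n x i m => ∑ j, ∑ k, if φ n x (i, j, k) m then g n x m else 0)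
  simpa only [Finset.card_filter, Finset.sum_mul, Fintype.sum_prod_type, ite_mul, one_mul,
    zero_mul] using h

/-- The memory after writing `v` into cell `i` of array `a`. -/
def Memory.write (m : Memory) (a i v : ℕ) : Memory :=
  Function.update m a (Function.update (m a) i v)

theorem Memory.write_apply (m : Memory) (a i v c j : ℕ) :
    m.write a i v c j = if c = a ∧ j = i then v else m c j := by
  rcases eq_or_ne c a with rfl | h
  · simp [Memory.write, Function.update_apply]
  · simp [Memory.write, h]

namespace Transforms

theorem comp (hf' : Transforms f') (hf : Transforms f) :
    Transforms fun n x m => f' n x (f n x m) := by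
  obtain ⟨P, p, hP⟩ := hf
  obtain ⟨P', p', hP'⟩ := hf'
  refine ⟨fun ρ b => .seq (P ρ b) (P' ρ b), p + p', fun ρ b n x m s h => ?_⟩
  simpa using exec_seq ((hP ρ b n x m s h).mono le_rfl le_rfl fun s₁ hs₁ harr =>
    hP' ρ b n x _ s₁ (h.of_frame le_rfl hs₁ harr))

theorem write (a : ℕ) (hg : Computes g) (hg' : Computes g') :
    Transforms fun n x m => m.write a (g n x m) (g' n x m) := by
  obtain ⟨P, p, hP⟩ := hg
  obtain ⟨P', p', hP'⟩ := hg'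
  refine ⟨fun ρ b => .seq (P ρ b) (.seq (P' ρ (b + 1)) (.store a b (b + 1))), p + (p' + 1),
    fun ρ b n x m s h => ?_⟩
  simpa using exec_seq ((hP ρ b n x m s h).mono le_rfl le_rfl fun s₁ hs₁ ⟨harr, hval⟩ =>
    exec_seq ((hP' ρ (b + 1) n x m s₁ (h.of_frame (by omega) hs₁ harr)).mono (by omega) le_rfl
      fun s₂ hs₂ ⟨harr', hval'⟩ => exec_store
        (by simp [State.setArr, Memory.write, harr', hval', hs₂ b (by omega), hval])))

theorem when [∀ n x m, Decidable (φ n x m)] (hφ : Decides φ) (hf : Transforms f) :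
    Transforms fun n x m => if φ n x m then f n x m else m := by
  obtain ⟨d, ⟨P, p, hP⟩, hd⟩ := hφ
  obtain ⟨P', p', hP'⟩ := hf
  refine ⟨fun ρ b => .seq (P ρ b) (.cond b (P' ρ b) (.const b 0)), p + (p' + 1 + 1),
    fun ρ b n x m s h => ?_⟩
  simp only [Polynomial.eval_add, Polynomial.eval_one]
  refine exec_seq ((hP ρ b n x m s h).mono le_rfl le_rfl fun s₁ hs₁ ⟨harr, hval⟩ => ?_)
  refine exec_cond (fun hb => ?_) fun hb => ?_
  · rw [if_pos ((hd n x m).1 (hval ▸ hb))]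
    exact (hP' ρ b n x m s₁ (h.of_frame le_rfl hs₁ harr)).mono le_rfl (by omega) fun _ _ h => h
  · rw [if_neg fun hφ => (hd n x m).2 hφ (hval ▸ hb)]
    exact (exec_const le_rfl harr).mono le_rfl (by omega) fun _ _ h => h

theorem foldl {f : ∀ n, (ι → Fin n) → Fin n → Memory → Memory}
    (hf : Transforms fun n (x : Option ι → Fin n) m => f n (fun i => x (some i)) (x none) m) :
    Transforms fun n x m => (List.finRange n).foldl (fun m i => f n x i m) m := by
  obtain ⟨P, p, hP⟩ := hf
  refine ⟨fun ρ b => forProg b (P (fun o => o.elim b ρ) (b + 3)), .X * (p + 3) + 4,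
    fun ρ b n x m s h => ?_⟩
  simpa using h.exec_forProg (I := fun l _ m' => m' = l.foldl (fun m i => f n x i m) m) rfl
    fun l i m' s₁ h₁ hm' => (hP _ (b + 3) n _ m' s₁ h₁).mono le_rfl le_rfl
      fun s₂ _ harr => by simp [harr, hm']

end Transforms

end Closure

/-! ### Reconstruction of the base graph -/

section Algorithm

/-- The cell of entry `p` of a matrix of size `n` that is stored row by row. -/
def pairCell {n : ℕ} (p : Fin n × Fin n) : ℕ :=
  finProdFinEquiv p

/-- The cell of the entry for the pairs `p` and `q`. -/
def labelCell {n : ℕ} (p q : Fin n × Fin n) : ℕ :=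
  finProdFinEquiv (finProdFinEquiv (finProdFinEquiv p, q.1), q.2)

/-- A numbering of the triples of indices. -/
def code {n : ℕ} (w : Fin n × Fin n × Fin n) : ℕ :=
  finProdFinEquiv (finProdFinEquiv (w.1, w.2.1), w.2.2)

/-- The graph whose adjacency matrix is in array `2`. -/
def graph (n : ℕ) (m : Memory) : SimpleGraph (Fin n) :=
  .fromRel fun x y => m 2 (pairCell (x, y)) ≠ 0

/-- The reflexive relation between pairs that is recorded in array `1`. -/
def labelRel (n : ℕ) (m : Memory) (p q : Fin n × Fin n) : Prop :=
  p = q ∨ m 1 (labelCell p q) ≠ 0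

open Classical in
/-- The number of representatives, that is, the number of vertices of the base graph. -/
noncomputable def numReps {n : ℕ} (Γ : SimpleGraph (Fin n))
    (L : Fin n × Fin n → Fin n × Fin n → Prop) : ℕ :=
  (Finset.univ.filter (IsRep Γ L code)).card

open Classical in
/-- The number which a representative gets as a vertex of the output. -/
noncomputable def rank {n : ℕ} (Γ : SimpleGraph (Fin n))
    (L : Fin n × Fin n → Fin n × Fin n → Prop) (w : Fin n × Fin n × Fin n) : ℕ :=
  (Finset.univ.filter fun w' => IsRep Γ L code w' ∧ code w' < code w).card

/-- The cell of the entry for the representatives `w` and `w'` in the adjacency matrix of the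
output. -/
noncomputable def baseCell {n : ℕ} (Γ : SimpleGraph (Fin n))
    (L : Fin n × Fin n → Fin n × Fin n → Prop) (w w' : Fin n × Fin n × Fin n) : ℕ :=
  rank Γ L w * numReps Γ L + rank Γ L w'

/-- The list of all pairs of indices. -/
def pairs (n : ℕ) : List (Fin n × Fin n) :=
  List.finRange n ×ˢ List.finRange n

/-- The list of all triples of indices. -/
def triples (n : ℕ) : List (Fin n × Fin n × Fin n) :=
  List.finRange n ×ˢ pairs n

/-- Copy the adjacency matrix in array `0` to array `2`. -/
def copyGraph (n : ℕ) (m : Memory) : Memory :=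
  (pairs n).foldl (fun m p => m.write 2 (pairCell p) (m 0 (pairCell p))) m

open Classical in
/-- One step of Warshall's algorithm: add the step from `p` to `q` to the recorded relation. -/
noncomputable def joinLabels (n : ℕ) (p q : Fin n × Fin n) (m : Memory) : Memory :=
  (pairs n ×ˢ pairs n).foldl (fun m e =>
    if labelRel n m e.1 p ∧ labelRel n m q e.2 then m.write 1 (labelCell e.1 e.2) 1 else m) m

open Classical in
/-- Close the recorded relation under the steps that generate the equality of labels. -/
noncomputable def closeLabels (n : ℕ) (m : Memory) : Memory :=
  (pairs n ×ˢ pairs n).foldl (fun m e =>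
    if LabelStep (graph n m) e.1 e.2 then joinLabels n e.1 e.2 m else m) m

open Classical in
/-- Write the adjacency matrix of the base graph to array `0`. -/
noncomputable def writeBase (n : ℕ) (m : Memory) : Memory :=
  (triples n ×ˢ triples n).foldl (fun m w =>
    if IsRep (graph n m) (labelRel n m) code w.1 ∧ IsRep (graph n m) (labelRel n m) code w.2 then
      m.write 0 (baseCell (graph n m) (labelRel n m) w.1 w.2)
        (if AdjVertex (graph n m) (labelRel n m) w.1 w.2 then 1 else 0)
    else m) m

section Complexity

variable {ι : Type} {i j k l i₁ j₁ k₁ l₁ : ι}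

theorem computes_pairCell : Computes fun n (x : ι → Fin n) _ => pairCell (x i, x j) :=
  .add (.var j) (.size_mul (.var i))

theorem computes_code : Computes fun n (x : ι → Fin n) _ => code (x i, x j, x k) :=
  .add (.var k) (.size_mul (.add (.var j) (.size_mul (.var i))))

theorem computes_labelCell :
    Computes fun n (x : ι → Fin n) _ => labelCell (x i, x j) (x k, x l) :=
  .add (.var l) (.size_mul (.add (.var k) (.size_mul computes_pairCell)))

theorem decides_adj : Decides fun n (x : ι → Fin n) m => (graph n m).Adj (x i) (x j) :=
  .and (.not (.var_eq i j))
    (.or (.ne_zero (.cell 2 computes_pairCell)) (.ne_zero (.cell 2 computes_pairCell)))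

theorem decides_labelRel :
    Decides fun n (x : ι → Fin n) m => labelRel n m (x i, x j) (x k, x l) := by
  simpa only [labelRel, Prod.mk.injEq] using
    ((Decides.var_eq i k).and (.var_eq j l)).or (.ne_zero (.cell 1 computes_labelCell))

theorem decides_oppositeEdges : Decides fun n (x : ι → Fin n) m =>
    OppositeEdges (graph n m) (x i) (x j) (x k) (x l) :=
  .and decides_adj <| .and decides_adj <| .and decides_adj <| .and decides_adj <|
    .and (.not (.var_eq _ _)) <| .and (.not decides_adj) <|
      .and (.not (.var_eq _ _)) (.not decides_adj)

theorem decides_labelStep : Decides fun n (x : ι → Fin n) m =>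
    LabelStep (graph n m) (x i, x j) (x k, x l) :=
  .or decides_oppositeEdges <| .and decides_adj (.and (.var_eq _ _) (.var_eq _ _))

theorem decides_isWedge : Decides fun n (x : ι → Fin n) m =>
    IsWedge (graph n m) (x i, x j, x k) :=
  .and decides_adj <| .and decides_adj <| .and (.not (.var_eq _ _)) <|
    .not <| .exists_index decides_oppositeEdges

theorem decides_meet : Decides fun n (x : ι → Fin n) m =>
    Meet (graph n m) (labelRel n m) (x i, x j) (x k, x l) :=
  .exists_index <| .exists_index <| .exists_index <|
    .and decides_isWedge (.and decides_labelRel decides_labelRel)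

theorem decides_triangular : Decides fun n (x : ι → Fin n) m =>
    Triangular (graph n m) (labelRel n m) (x i, x j) (x k, x l) (x i₁, x j₁) :=
  .exists_index <| .exists_index <| .exists_index <|
    .and (.and decides_adj (.and decides_adj decides_adj))
      (.and decides_labelRel (.and decides_labelRel decides_labelRel))

theorem decides_incident : Decides fun n (x : ι → Fin n) m =>
    Incident (graph n m) (labelRel n m) (x i, x j, x k) (x i₁, x j₁) :=
  .and decides_adj <| .or decides_labelRel <| .or decides_labelRel <|
    .and decides_meet (.and decides_meet (.not decides_triangular))

theorem decides_sameVertex : Decides fun n (x : ι → Fin n) m =>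
    SameVertex (graph n m) (labelRel n m) (x i, x j, x k) (x i₁, x j₁, x k₁) :=
  .and decides_incident decides_incident

theorem decides_adjVertex : Decides fun n (x : ι → Fin n) m =>
    AdjVertex (graph n m) (labelRel n m) (x i, x j, x k) (x i₁, x j₁, x k₁) :=
  .and (.not decides_sameVertex) <|
    .exists_index <| .exists_index <| .and decides_incident decides_incident

theorem decides_isRep : Decides fun n (x : ι → Fin n) m =>
    IsRep (graph n m) (labelRel n m) code (x i, x j, x k) :=
  .and decides_isWedge <| .forall_index <| .forall_index <| .forall_index <|
    .imp decides_isWedge <| .imp decides_sameVertex (.le computes_code computes_code)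

theorem computes_numReps :
    Computes fun n (_ : ι → Fin n) m => numReps (graph n m) (labelRel n m) := by
  classical
  simpa only [numReps, mul_one] using
    Computes.card_mul (φ := fun n _ w m => IsRep (graph n m) (labelRel n m) code w) decides_isRep
      (.const 1)

theorem computes_rank_mul {g : ∀ n, (ι → Fin n) → Memory → ℕ} (hg : Computes g) :
    Computes fun n x m => rank (graph n m) (labelRel n m) (x i, x j, x k) * g n x m := by
  classical
  simpa only [rank] using Computes.card_mul (φ := fun n x w m =>
    IsRep (graph n m) (labelRel n m) code w ∧ code w < code (x i, x j, x k))
    (.and decides_isRep (.lt computes_code computes_code)) hg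

theorem computes_baseCell : Computes fun n (x : ι → Fin n) m =>
    baseCell (graph n m) (labelRel n m) (x i, x j, x k) (x i₁, x j₁, x k₁) := by
  simpa only [baseCell, mul_one] using
    (computes_rank_mul computes_numReps).add (computes_rank_mul (.const 1))

theorem Transforms.foldl_pairs {f : ∀ n, (ι → Fin n) → Fin n × Fin n → Memory → Memory}
    (hf : Transforms fun n (x : Option (Option ι) → Fin n) m =>
      f n (fun i => x (some (some i))) (x (some none), x none) m) :
    Transforms fun n x m => (pairs n).foldl (fun m p => f n x p m) m := by
  simpa only [pairs, foldl_product] using foldl (f := fun n x i m =>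
    (List.finRange n).foldl (fun m j => f n x (i, j) m) m) (foldl hf)

theorem Transforms.foldl_triples
    {f : ∀ n, (ι → Fin n) → Fin n × Fin n × Fin n → Memory → Memory}
    (hf : Transforms fun n (x : Option (Option (Option ι)) → Fin n) m =>
      f n (fun i => x (some (some (some i)))) (x (some (some none)), x (some none), x none) m) :
    Transforms fun n x m => (triples n).foldl (fun m w => f n x w m) m := by
  simpa only [triples, foldl_product] using foldl (f := fun n x i m =>
    (pairs n).foldl (fun m p => f n x (i, p) m) m) (foldl_pairs hf)

theorem transforms_copyGraph : Transforms fun n (_ : ι → Fin n) m => copyGraph n m :=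
  .foldl_pairs <| .write 2 computes_pairCell (.cell 0 computes_pairCell)

theorem transforms_joinLabels :
    Transforms fun n (x : ι → Fin n) m => joinLabels n (x i, x j) (x k, x l) m := by
  classical
  simp only [joinLabels, foldl_product]
  exact .foldl_pairs <| .foldl_pairs <|
    .when (.and decides_labelRel decides_labelRel) (.write 1 computes_labelCell (.const 1))

theorem transforms_closeLabels : Transforms fun n (_ : ι → Fin n) m => closeLabels n m := by
  classical
  simp only [closeLabels, foldl_product]
  exact .foldl_pairs <| .foldl_pairs <| .when decides_labelStep transforms_joinLabels

theorem transforms_writeBase : Transforms fun n (_ : ι → Fin n) m => writeBase n m := by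
  classical
  simp only [writeBase, foldl_product]
  exact .foldl_triples <| .foldl_triples <| .when (.and decides_isRep decides_isRep)
    (.write 0 computes_baseCell (.ite decides_adjVertex (.const 1) (.const 0)))

end Complexity

section Correctness

variable {n : ℕ} {m m' : Memory} {Γ : SimpleGraph (Fin n)}
  {L : Fin n × Fin n → Fin n × Fin n → Prop} {w w' u u' : Fin n × Fin n × Fin n}

theorem pairCell_injective : (pairCell (n := n)).Injective :=
  Fin.val_injective.comp finProdFinEquiv.injective

theorem labelCell_inj {p q r s : Fin n × Fin n} :
    labelCell p q = labelCell r s ↔ p = r ∧ q = s := by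
  simp only [labelCell, Fin.val_inj, EmbeddingLike.apply_eq_iff_eq, Prod.ext_iff, and_assoc]

theorem code_injective : (code (n := n)).Injective := fun w w' h => by
  simpa only [code, Fin.val_inj, EmbeddingLike.apply_eq_iff_eq, Prod.ext_iff, and_assoc] using h

theorem graph_congr (h : m 2 = m' 2) : graph n m = graph n m' := by
  simp only [graph, h]

theorem labelRel_congr (h : m 1 = m' 1) : labelRel n m = labelRel n m' := by
  ext p q
  simp only [labelRel, h]

theorem labelRel_write {p q r s : Fin n × Fin n} :
    labelRel n (m.write 1 (labelCell r s) 1) p q ↔ labelRel n m p q ∨ p = r ∧ q = s := by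
  by_cases h : p = r ∧ q = s <;> simp [labelRel, Memory.write_apply, labelCell_inj, h]

theorem mem_pairs (p : Fin n × Fin n) : p ∈ pairs n :=
  List.mem_product.2 ⟨List.mem_finRange _, List.mem_finRange _⟩

theorem mem_triples (w : Fin n × Fin n × Fin n) : w ∈ triples n :=
  List.mem_product.2 ⟨List.mem_finRange _, mem_pairs _⟩

theorem copyGraph_spec (n : ℕ) (m : Memory) :
    (∀ c ≠ 2, copyGraph n m c = m c) ∧
      ∀ p : Fin n × Fin n, copyGraph n m 2 (pairCell p) = m 0 (pairCell p) := by
  let P (D : Set (Fin n × Fin n)) (m' : Memory) : Prop :=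
    (∀ c ≠ 2, m' c = m c) ∧ ∀ p ∈ D, m' 2 (pairCell p) = m 0 (pairCell p)
  have h : P Set.univ (copyGraph n m) := foldl_invariant mem_pairs (by simp [P])
    fun D m' p ⟨hother, hcopied⟩ => ⟨fun c hc => by simp [Memory.write, hc, hother c hc],
      fun q hq => by
        rw [Memory.write_apply, hother 0 (by simp)]
        grind [pairCell_injective.eq_iff, hcopied q]⟩
  exact ⟨h.1, fun p => h.2 p trivial⟩

theorem input_pairCell (F : SimpleGraph (Fin n)) (i j : Fin n) :
    (input F).arr 0 (pairCell (i, j)) ≠ 0 ↔ F.Adj i j := by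
  have hcell : ∀ i j : Fin n, (i * n + j : ℕ) = pairCell (i, j) := fun i j => by
    simp [pairCell, mul_comm, add_comm]
  simp [input, hcell, pairCell_injective.eq_iff]

theorem graph_copyGraph_input (F : SimpleGraph (Fin n)) :
    graph n (copyGraph n (input F).arr) = F := by
  ext i j
  simp only [graph, SimpleGraph.fromRel_adj, (copyGraph_spec n _).2, input_pairCell, F.adj_comm j,
    or_self, and_iff_right_iff_imp]
  exact SimpleGraph.Adj.ne

theorem labelRel_copyGraph_input (F : SimpleGraph (Fin n)) :
    labelRel n (copyGraph n (input F).arr) = Eq := by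
  ext p q
  simp [labelRel, (copyGraph_spec n _).1, input]

theorem joinLabels_spec (p q : Fin n × Fin n) (m : Memory) :
    joinLabels n p q m 2 = m 2 ∧ ∀ r s, labelRel n (joinLabels n p q m) r s ↔
      labelRel n m r s ∨ labelRel n m r p ∧ labelRel n m q s := by
  let P (D : Set ((Fin n × Fin n) × Fin n × Fin n)) (m' : Memory) : Prop :=
    m' 2 = m 2 ∧ ∀ r s, labelRel n m' r s ↔
      labelRel n m r s ∨ (r, s) ∈ D ∧ labelRel n m r p ∧ labelRel n m q s
  have h : P Set.univ (joinLabels n p q m) :=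
    foldl_invariant (fun e => List.mem_product.2 ⟨mem_pairs e.1, mem_pairs e.2⟩) (by simp [P])
      fun D m' ⟨r, s⟩ ⟨harr, hrel⟩ => by
        have hr : labelRel n m' r p ↔ labelRel n m r p := by grind [hrel r p]
        have hs : labelRel n m' q s ↔ labelRel n m q s := by grind [hrel q s]
        split_ifs with hrs
        · refine ⟨by simp [Memory.write, harr], fun r' s' => ?_⟩
          rw [labelRel_write]
          grind
        · exact ⟨harr, by grind⟩
  exact ⟨h.1, fun r s => (h.2 r s).trans (by simp)⟩

theorem closeLabels_spec (hm : labelRel n m = Eq) :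
    closeLabels n m 2 = m 2 ∧ labelRel n (closeLabels n m) = SameLabel (graph n m) := by
  let P (D : Set ((Fin n × Fin n) × Fin n × Fin n)) (m' : Memory) : Prop :=
    m' 2 = m 2 ∧ ∀ r s, labelRel n m' r s ↔
      Relation.ReflTransGen (fun p q => (p, q) ∈ D ∧ LabelStep (graph n m) p q) r s
  have h : P Set.univ (closeLabels n m) :=
    foldl_invariant (fun e => List.mem_product.2 ⟨mem_pairs e.1, mem_pairs e.2⟩)
      ⟨rfl, fun r s => by simp [hm, Relation.reflTransGen_iff_eq, eq_comm]⟩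
      fun D m' ⟨p, q⟩ ⟨harr, hrel⟩ => by
        rw [graph_congr harr]
        split_ifs with hpq
        · have hjoin := joinLabels_spec p q m'
          refine ⟨hjoin.1.trans harr, fun r s => ?_⟩
          rw [hjoin.2, hrel, hrel, hrel, ← reflTransGen_insert_iff]
          grind
        · have hD : ∀ r s, ((r, s) ∈ insert (p, q) D ∧ LabelStep (graph n m) r s) ↔
              ((r, s) ∈ D ∧ LabelStep (graph n m) r s) := by grind
          exact ⟨harr, by simpa only [hD] using hrel⟩
  exact ⟨h.1, funext₂ fun r s => propext ((h.2 r s).trans (by simp [SameLabel]))⟩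

theorem exists_isRep_equiv_fin (Γ : SimpleGraph (Fin n))
    (L : Fin n × Fin n → Fin n × Fin n → Prop) :
    ∃ e : {w // IsRep Γ L code w} ≃ Fin (numReps Γ L), ∀ w, (e w : ℕ) = rank Γ L w.1 := by
  obtain ⟨e, he⟩ := exists_equiv_fin_card_lt (IsRep Γ L code) code_injective
  exact ⟨e, he⟩

theorem baseCell_inj (hw : IsRep Γ L code w) (hw' : IsRep Γ L code w') (hu : IsRep Γ L code u)
    (hu' : IsRep Γ L code u') : baseCell Γ L w w' = baseCell Γ L u u' ↔ w = u ∧ w' = u' := by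
  obtain ⟨e, he⟩ := exists_isRep_equiv_fin Γ L
  have hcell : ∀ v v' : {w // IsRep Γ L code w}, baseCell Γ L v v' = pairCell (e v, e v') :=
    fun v v' => by simp [baseCell, pairCell, he, mul_comm, add_comm]
  rw [hcell ⟨w, hw⟩ ⟨w', hw'⟩, hcell ⟨u, hu⟩ ⟨u', hu'⟩, pairCell_injective.eq_iff]
  simp

open Classical in
theorem writeBase_spec (hΓ : graph n m = Γ) (hL : labelRel n m = L) :
    graph n (writeBase n m) = Γ ∧ labelRel n (writeBase n m) = L ∧
      ∀ w w', IsRep Γ L code w → IsRep Γ L code w' →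
        writeBase n m 0 (baseCell Γ L w w') = if AdjVertex Γ L w w' then 1 else 0 := by
  let P (D : Set ((Fin n × Fin n × Fin n) × Fin n × Fin n × Fin n)) (m' : Memory) : Prop :=
    m' 1 = m 1 ∧ m' 2 = m 2 ∧ ∀ w w', (w, w') ∈ D → IsRep Γ L code w → IsRep Γ L code w' →
      m' 0 (baseCell Γ L w w') = if AdjVertex Γ L w w' then 1 else 0
  have h : P Set.univ (writeBase n m) :=
    foldl_invariant (fun w => List.mem_product.2 ⟨mem_triples w.1, mem_triples w.2⟩)
      ⟨rfl, rfl, by simp⟩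
      fun D m' ⟨u, u'⟩ ⟨h₁, h₂, hcells⟩ => by
        simp only [graph_congr h₂, labelRel_congr h₁, hΓ, hL]
        by_cases hu : IsRep Γ L code u ∧ IsRep Γ L code u'
        · rw [if_pos hu]
          refine ⟨by simp [Memory.write, h₁], by simp [Memory.write, h₂],
            fun w w' hD hw hw' => ?_⟩
          simp only [Memory.write_apply, baseCell_inj hw hw' hu.1 hu.2]
          grind
        · rw [if_neg hu]
          exact ⟨h₁, h₂, fun w w' hD hw hw' => hcells w w' (by grind) hw hw'⟩
  exact ⟨(graph_congr h.2.1).trans hΓ, (labelRel_congr h.1).trans hL,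
    fun w w' => h.2.2 w w' trivial⟩

open Classical in
theorem exists_holds_of_isRep_equiv {V : Type*} {G : SimpleGraph V} {s : State}
    (e : {w // IsRep Γ L code w} ≃ V)
    (he : ∀ w w', AdjVertex Γ L w.1 w'.1 ↔ G.Adj (e w) (e w')) (hsize : s.reg 0 = numReps Γ L)
    (hcells : ∀ w w', IsRep Γ L code w → IsRep Γ L code w' →
      s.arr 0 (baseCell Γ L w w') = if AdjVertex Γ L w w' then 1 else 0) :
    ∃ H : SimpleGraph (Fin (numReps Γ L)), Holds s H ∧ Nonempty (H ≃g G) := by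
  obtain ⟨r, hr⟩ := exists_isRep_equiv_fin Γ L
  refine ⟨G.comap (r.symm.trans e), ⟨hsize, fun i j => ?_⟩, ⟨⟨r.symm.trans e, Iff.rfl⟩⟩⟩
  have hcell := hcells _ _ (r.symm i).2 (r.symm j).2
  simp only [baseCell, ← hr, Equiv.apply_symm_apply, he] at hcell
  exact ⟨fun h => hcell.trans (if_pos h), fun h => hcell.trans (if_neg h)⟩

end Correctness

theorem Transforms.exists_prog {f : ∀ n, (Empty → Fin n) → Memory → Memory}
    {g : ∀ n, (Empty → Fin n) → Memory → ℕ} (hf : Transforms f) (hg : Computes g) :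
    ∃ (P : Prog) (p : Polynomial ℕ), ∀ (N : ℕ) (F : SimpleGraph (Fin N)),
      Exec P 0 (p.eval N) (input F) fun s =>
        s.arr = f N Empty.elim (input F).arr ∧ s.reg 0 = g N Empty.elim s.arr := by
  obtain ⟨P, p, hP⟩ := hf
  obtain ⟨Q, q, hQ⟩ := hg
  refine ⟨.seq (P Empty.elim 1) (.seq (Q Empty.elim 1) (.copy 0 1)), p + (q + 1), fun N F => ?_⟩
  have hstart : Represents Empty.elim 1 Empty.elim (input F).arr (input F) :=
    ⟨one_pos, nofun, rfl, nofun, rfl⟩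
  simp only [Polynomial.eval_add, Polynomial.eval_one]
  exact exec_seq ((hP _ 1 N _ _ _ hstart).mono zero_le_one le_rfl fun s hs harr =>
    exec_seq ((hQ _ 1 N _ _ s (hstart.of_frame le_rfl hs rfl)).mono zero_le_one le_rfl
      fun s' _ ⟨harr', hval⟩ => exec_copy le_rfl
        ⟨harr'.trans harr, by rw [setReg_reg, if_pos rfl, hval, setReg_arr, harr']; rfl⟩))

open Classical in
theorem exists_prog_isRep : ∃ (P : Prog) (p : Polynomial ℕ), ∀ (N : ℕ) (F : SimpleGraph (Fin N)),
    ∃ t s, Runs P (input F) s t ∧ t ≤ p.eval N ∧ s.reg 0 = numReps F (SameLabel F) ∧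
      ∀ w w', IsRep F (SameLabel F) code w → IsRep F (SameLabel F) code w' →
        s.arr 0 (baseCell F (SameLabel F) w w') =
          if AdjVertex F (SameLabel F) w w' then 1 else 0 := by
  obtain ⟨P, p, hP⟩ := Transforms.exists_prog
    (transforms_writeBase.comp (transforms_closeLabels.comp transforms_copyGraph)) computes_numReps
  refine ⟨P, p, fun N F => ?_⟩
  obtain ⟨s, t, hrun, ht, -, harr, hsize⟩ := hP N F
  have hclose := closeLabels_spec (labelRel_copyGraph_input F)
  have hgraph := (graph_congr hclose.1).trans (graph_copyGraph_input F)
  rw [graph_copyGraph_input] at hclose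
  obtain ⟨hΓ, hL, hcells⟩ := writeBase_spec hgraph hclose.2
  exact ⟨t, s, hrun, ht, by rw [hsize, harr, hΓ, hL], by simpa only [harr] using hcells⟩

end Algorithm

end RAM

theorem mainTheorem10_general :
    ∃ (P : RAM.Prog) (p : Polynomial ℕ),
      ∀ (V : Type*) [Fintype V] [DecidableEq V] (G : SimpleGraph V) (k N : ℕ)
        (F : SimpleGraph (Fin N)),
        (∀ a c, G.Adj a c → (G.induce {v : V | v ∉ ({a, c} : Finset V)}).Preconnected) →
        (∀ b, ∃ a d, G.Adj b a ∧ G.Adj b d ∧ a ≠ d) → IsC4DiamondFree G →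
        1 ≤ k → k < Fintype.card V →
        Nonempty (F ≃g tokenGraph G k) →
        ∃ (t m : ℕ) (s : RAM.State) (H : SimpleGraph (Fin m)),
          RAM.Runs P (RAM.input F) s t ∧ t ≤ p.eval N ∧
          RAM.Holds s H ∧ Nonempty (H ≃g G) := by
  obtain ⟨P, p, hP⟩ := RAM.exists_prog_isRep
  refine ⟨P, p, fun V _ _ G k N F hcon hdeg hG hk₁ hk ⟨τ⟩ => ?_⟩
  obtain ⟨b⟩ : Nonempty V := Fintype.card_pos_iff.1 (by omega)
  obtain ⟨a, d, hba, hbd, had⟩ := hdeg b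
  have hcard : 2 < Fintype.card V := Fintype.two_lt_card_iff.2 ⟨b, a, d, hba.ne, hbd.ne, had⟩
  obtain ⟨j, hj₁, hj, ⟨σ⟩⟩ :
      ∃ j, 1 ≤ j ∧ j + 2 ≤ Fintype.card V ∧ Nonempty (F ≃g tokenGraph G j) := by
    by_cases h : k + 2 ≤ Fintype.card V
    · exact ⟨k, hk₁, h, ⟨τ⟩⟩
    · exact ⟨Fintype.card V - k, by omega, by omega, ⟨τ.trans (tokenGraphCompl G hk.le)⟩⟩
  obtain ⟨e, he⟩ := exists_isRep_equiv σ (isLabelEq_sameLabel σ hG hcon) hG hj₁ hj hdeg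
    RAM.code_injective
  obtain ⟨t, s, hrun, ht, hsize, hcells⟩ := hP N F
  obtain ⟨H, hs, hH⟩ := RAM.exists_holds_of_isRep_equiv e he hsize hcells
  exact ⟨t, _, s, H, hrun, ht, hs, hH⟩

theorem mainTheorem10 :
    ∃ (P : RAM.Prog) (p : Polynomial ℕ),
      ∀ (V : Type*) [Fintype V] [DecidableEq V] (G : SimpleGraph V) (k N : ℕ)
        (F : SimpleGraph (Fin N)),
        IsVertexConnected G 3 → IsC4DiamondFree G →
        1 ≤ k → k < Fintype.card V →
        Nonempty (F ≃g tokenGraph G k) →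
        ∃ (t m : ℕ) (s : RAM.State) (H : SimpleGraph (Fin m)),
          RAM.Runs P (RAM.input F) s t ∧ t ≤ p.eval N ∧
          RAM.Holds s H ∧ Nonempty (H ≃g G) := by
  obtain ⟨P, p, hP⟩ := mainTheorem10_general
  exact ⟨P, p, fun V _ _ G k N F hcon => hP V G k N F
    (fun a c _ => hcon.preconnected_induce_pair (by omega) a c)
    (hcon.exists_two_neighbors (by omega))⟩
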